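/- Let $(Y,X^{(1)},\dots,X^{(p)})$ be a real random vector with $\mathbb E(Y^4)<\infty$, $\mathbb E((X^{(j)})^4)<\infty$ for all $j$, and $\mathrm{Var}(Y)>0$. Assume that $\mathbf 1,X^{(1)},\dots,X^{(p)}$ are linearly independent in $\mathbb L^2$, i.e. no nontrivial linear combination of them vanishes almost surely. *Population quantities.* Let $\mathrm{Proj}_{\mathcal V}(Y)=\alpha_0+\alpha_1X^{(1)}+\cdots+\alpha_pX^{(p)}$ be the orthogonal projection in $\mathbb L^2$ of $Y$ onto $\mathcal V=\mathrm{span}(\mathbf 1,X^{(1)},\dots,X^{(p)})$, let $\varepsilon=Y-\mathrm{Proj}_{\mathcal V}(Y)$ and $$R^2=\frac{\mathrm{Var}(\mathrm{Proj}_{\mathcal V}(Y))}{\mathrm{Var}(Y)}.$$ Let $\theta_k=\mathrm{Cov}(Y,X^{(k)})/\mathrm{Var}(Y)$, and $e^{(k)}=X^{(k)}-\mathrm{Proj}_{W}(X^{(k)})$ with $W=\mathrm{span}(\mathbf 1,Y)$. Let $\mathbf A$ be the symmetric $2p\times 2p$ matrix with, for $1\le j,k\le p$, $$\mathbf A_{j,k}=\mathbb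 E[(X^{(j)}-\mathbb E X^{(j)})(X^{(k)}-\mathbb E X^{(k)})\varepsilon^2],\quad \mathbf A_{p+j,p+k}=\mathbb E[(Y-\mathbb E Y)^2e^{(j)}e^{(k)}],\quad \mathbf A_{j,p+k}=\mathbb E[(X^{(j)}-\mathbb E X^{(j)})(Y-\mathbb E Y)\,\varepsilon\, e^{(k)}].$$ Let $\mathbf B$ be the block diagonal matrix with diagonal blocks $\mathbf M_0^{-1}$ and $\mathrm{Var}(Y)^{-1}I_p$, where $(\mathbf M_0)_{j,\ell}=\mathrm{Cov}(X^{(j)},X^{(\ell)})$, and let $$V=v^t\,\mathbf B\mathbf A\mathbf B\,v,\qquad v=(\theta_1,\dots,\theta_p,\alpha_1,\dots,\alpha_p)^t.$$ *Empirical quantities.* Let $(Y_i,X_i^{(1)},\dots,X_i^{(p)})_{i\ge1}$ be independent copies of $(Y,X^{(1)},\dots,X^{(p)})$. For $n\ge1$, a bar denotes the empirical mean over $i=1,\dots,n$, and $\mathrm{Var}_n(\mathbf z)=\frac1n\sum_{i=1}^n(z_i-\overline z)^2$ for $\mathbf z\in\mathbb R^n$. Let $\mathbf Y=(Y_1,\dots,Y_n)^t$,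 let $\mathbf X$ be the $n\times(p+1)$ matrix with rows $(1,X_i^{(1)},\dots,X_i^{(p)})$, let $\mathbb X_0=(X_i^{(j)}-\overline X^{(j)})_{1\le i\le n,\,1\le j\le p}$, and let $\Pi$ be the Euclidean orthogonal projection of $\mathbb R^n$ onto the span of the columns of $\mathbf X$. Put $$\widehat R^2=\frac{\mathrm{Var}_n(\Pi\mathbf Y)}{\mathrm{Var}_n(\mathbf Y)},\qquad (\widehat\alpha_0,\dots,\widehat\alpha_p)^t=(\mathbf X^t\mathbf X)^{-1}\mathbf X^t\mathbf Y,\qquad \widehat\theta_k=\frac{\sum_{i=1}^n(Y_i-\overline Y)(X_i^{(k)}-\overline X^{(k)})}{\sum_{i=1}^n(Y_i-\overline Y)^2},$$ $\widehat\varepsilon_i=Y_i-\widehat\alpha_0-\sum_{j=1}^p\widehat\alpha_jX_i^{(j)}$ and $\widehat e_i^{(k)}=(X_i^{(k)}-\overline X^{(k)})-\widehat\theta_k(Y_i-\overline Y)$. Let $\widehat{\mathbf A}$ be the symmetric $2p\times2p$ matrix with, for $1\le j,k\le p$, $$\widehat{\mathbf A}_{j,k}=\frac1n\sum_{i=1}^n(X_i^{(j)}-\overline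 X^{(j)})(X_i^{(k)}-\overline X^{(k)})\widehat\varepsilon_i^{\,2},\quad \widehat{\mathbf A}_{p+j,p+k}=\frac1n\sum_{i=1}^n(Y_i-\overline Y)^2\,\widehat e_i^{(j)}\widehat e_i^{(k)},\quad \widehat{\mathbf A}_{j,p+k}=\frac1n\sum_{i=1}^n(X_i^{(j)}-\overline X^{(j)})(Y_i-\overline Y)\,\widehat\varepsilon_i\,\widehat e_i^{(k)}.$$ Let $\widehat{\mathbf B}$ be the block diagonal matrix with diagonal blocks $n(\mathbb X_0^t\mathbb X_0)^{-1}$ and $\mathrm{Var}_n(\mathbf Y)^{-1}I_p$, and let $$\widehat V_n=\widehat v^{\,t}\,\widehat{\mathbf B}\widehat{\mathbf A}\widehat{\mathbf B}\,\widehat v,\qquad \widehat v=(\widehat\theta_1,\dots,\widehat\theta_p,\widehat\alpha_1,\dots,\widehat\alpha_p)^t.$$ (Almost surely the inverses and quotients above are well defined for all $n$ large enough; where they are not, they may be given an arbitrary value, such as $0$.) **Claim.** Assume $V>0$. Let $\delta\in(0,1)$ and let $c_{1-\delta/2}$ be the quantile of order $1-\delta/2$ of $\mathcal N(0,1)$.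 Then the interval $$\left[\widehat R^2-\frac{c_{1-\delta/2}\sqrt{\widehat V_n}}{\sqrt n},\ \widehat R^2+\frac{c_{1-\delta/2}\sqrt{\widehat V_n}}{\sqrt n}\right]$$ is an asymptotic confidence interval for $R^2$ of level $1-\delta$, that is, $$\lim_{n\to\infty}\mathbb P\left(\widehat R^2-\frac{c_{1-\delta/2}\sqrt{\widehat V_n}}{\sqrt n}\le R^2\le\widehat R^2+\frac{c_{1-\delta/2}\sqrt{\widehat V_n}}{\sqrt n}\right)=1-\delta .$$ -/

import Mathlib

open MeasureTheory ProbabilityTheory Filter Topology Matrix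

namespace MultipleCorrelation

noncomputable section

/-! ### Population quantities -/

section Population

variable {Ω : Type*} [MeasurableSpace Ω]

open Classical in
/-- The class of a square integrable random variable in `L²(P)`; it is `0` for a function that is
not square integrable. -/
def toL2 (P : Measure Ω) (f : Ω → ℝ) : Lp ℝ 2 P :=
  if h : MemLp f 2 P then h.toLp f else 0

/-- The subspace of `L²(P)` generated by a finite family of random variables. -/
def spanL2 {m : ℕ} (P : Measure Ω) (U : Fin m → Ω → ℝ) : Submodule ℝ (Lp ℝ 2 P) :=
  Submodule.span ℝ (Set.range fun j => toL2 P (U j))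

instance {m : ℕ} (P : Measure Ω) (U : Fin m → Ω → ℝ) : FiniteDimensional ℝ (spanL2 P U) :=
  FiniteDimensional.span_of_finite ℝ (Set.finite_range _)

/-- The orthogonal projection in `L²(P)` of `Z` onto the subspace generated by the `U j`. -/
def projL2 {m : ℕ} (P : Measure Ω) (U : Fin m → Ω → ℝ) (Z : Ω → ℝ) : Lp ℝ 2 P :=
  (spanL2 P U).starProjection (toL2 P Z)

theorem exists_coeff {m : ℕ} (P : Measure Ω) (U : Fin m → Ω → ℝ) (Z : Ω → ℝ) :
    ∃ a : Fin m → ℝ, ∑ j, a j • toL2 P (U j) = projL2 P U Z :=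
  (Submodule.mem_span_range_iff_exists_fun ℝ).1
    (Submodule.starProjection_apply_mem (spanL2 P U) (toL2 P Z))

/-- Coefficients of the projection of `Z` on the family `U`:
`projL2 P U Z = ∑ j, a j • U j` in `L²(P)`. They are unique as soon as the `U j` are linearly
independent in `L²(P)`. -/
def projCoeff {m : ℕ} (P : Measure Ω) (U : Fin m → Ω → ℝ) (Z : Ω → ℝ) : Fin m → ℝ :=
  (exists_coeff P U Z).choose

/-- The residual `Z - Proj(Z)`. -/
def residual {m : ℕ} (P : Measure Ω) (U : Fin m → Ω → ℝ) (Z : Ω → ℝ) : Ω → ℝ :=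
  fun ω => Z ω - projL2 P U Z ω

variable {p : ℕ}

/-- The family `1, X⁽¹⁾, …, X⁽ᵖ⁾`. -/
def withConst (X : Fin p → Ω → ℝ) : Fin (p + 1) → Ω → ℝ :=
  Fin.cons (fun _ => (1 : ℝ)) X

/-- `1, X⁽¹⁾, …, X⁽ᵖ⁾` are linearly independent as random variables: no nontrivial linear
combination vanishes almost surely. -/
def LinIndepWithConst (P : Measure Ω) (X : Fin p → Ω → ℝ) : Prop :=
  ∀ γ : Fin (p + 1) → ℝ, (∀ᵐ ω ∂P, ∑ j, γ j * withConst X j ω = 0) → γ = 0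

/-- `R² = Var(Proj_V(Y)) / Var(Y)`, with `V` generated by `1, X⁽¹⁾, …, X⁽ᵖ⁾`. -/
def Rsq (P : Measure Ω) (Y : Ω → ℝ) (X : Fin p → Ω → ℝ) : ℝ :=
  Var[projL2 P (withConst X) Y; P] / Var[Y; P]

/-- The slopes `(α₁, …, α_p)` of the projection `Proj_V(Y) = α₀ + ∑ αⱼ X⁽ʲ⁾`. -/
def alpha (P : Measure Ω) (Y : Ω → ℝ) (X : Fin p → Ω → ℝ) : Fin p → ℝ :=
  fun j => projCoeff P (withConst X) Y j.succ

/-- `θ_k = Cov(Y, X⁽ᵏ⁾) / Var(Y)`. -/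
def theta (P : Measure Ω) (Y : Ω → ℝ) (X : Fin p → Ω → ℝ) : Fin p → ℝ :=
  fun k => cov[Y, X k; P] / Var[Y; P]

/-- `ε = Y - Proj_V(Y)`. -/
def eps (P : Measure Ω) (Y : Ω → ℝ) (X : Fin p → Ω → ℝ) : Ω → ℝ :=
  residual P (withConst X) Y

/-- `e⁽ᵏ⁾ = X⁽ᵏ⁾ - Proj_W(X⁽ᵏ⁾)`, with `W` generated by `1` and `Y`. -/
def eRes (P : Measure Ω) (Y : Ω → ℝ) (X : Fin p → Ω → ℝ) (k : Fin p) : Ω → ℝ :=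
  residual P (withConst fun _ : Fin 1 => Y) (X k)

/-- The covariance matrix of `(X⁽¹⁾, …, X⁽ᵖ⁾)`. -/
def M0 (P : Measure Ω) (X : Fin p → Ω → ℝ) : Matrix (Fin p) (Fin p) ℝ :=
  Matrix.of fun j l => cov[X j, X l; P]

/-- The symmetric `2p × 2p` matrix `A`, in `p × p` blocks. -/
def matA (P : Measure Ω) (Y : Ω → ℝ) (X : Fin p → Ω → ℝ) :
    Matrix (Fin p ⊕ Fin p) (Fin p ⊕ Fin p) ℝ :=
  let A₁₂ : Matrix (Fin p) (Fin p) ℝ := Matrix.of fun j k =>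
    ∫ ω, (X j ω - P[X j]) * (Y ω - P[Y]) * eps P Y X ω * eRes P Y X k ω ∂P
  Matrix.fromBlocks
    (Matrix.of fun j k => ∫ ω, (X j ω - P[X j]) * (X k ω - P[X k]) * eps P Y X ω ^ 2 ∂P)
    A₁₂
    A₁₂ᵀ
    (Matrix.of fun j k => ∫ ω, (Y ω - P[Y]) ^ 2 * eRes P Y X j ω * eRes P Y X k ω ∂P)

/-- The symmetric `2p × 2p` matrix `B`, with diagonal blocks `M₀⁻¹` and `Var(Y)⁻¹ I`. -/
def matB (P : Measure Ω) (Y : Ω → ℝ) (X : Fin p → Ω → ℝ) :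
    Matrix (Fin p ⊕ Fin p) (Fin p ⊕ Fin p) ℝ :=
  Matrix.fromBlocks (M0 P X)⁻¹ 0 0 ((Var[Y; P])⁻¹ • (1 : Matrix (Fin p) (Fin p) ℝ))

/-- The limiting variance `V = (θ, α) B A B (θ, α)ᵗ`. -/
def asympVar (P : Measure Ω) (Y : Ω → ℝ) (X : Fin p → Ω → ℝ) : ℝ :=
  let v : Fin p ⊕ Fin p → ℝ := Sum.elim (theta P Y X) (alpha P Y X)
  v ⬝ᵥ ((matB P Y X * matA P Y X * matB P Y X) *ᵥ v)

end Population

/-! ### Empirical quantities, for data `y i`, `x i j` with `i < n` and `j < p` -/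

section Sample

variable {n p : ℕ}

/-- Empirical mean. -/
def mean (z : Fin n → ℝ) : ℝ := (1 / (n : ℝ)) * ∑ i, z i

/-- Empirical variance `Var_n(z) = (1/n) ∑ (zᵢ - z̄)²`. -/
def varN (z : Fin n → ℝ) : ℝ := (1 / (n : ℝ)) * ∑ i, (z i - mean z) ^ 2

/-- The `n × (p+1)` design matrix, whose column `0` is constant equal to `1`. -/
def design (x : Fin n → Fin p → ℝ) : Matrix (Fin n) (Fin (p + 1)) ℝ :=
  Matrix.of fun i => Fin.cons (1 : ℝ) (x i)

/-- The subspace of `ℝⁿ` (with its Euclidean structure) generated by the columns of the design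
matrix. -/
def colSpan (x : Fin n → Fin p → ℝ) : Submodule ℝ (EuclideanSpace ℝ (Fin n)) :=
  Submodule.span ℝ (Set.range fun j => WithLp.toLp 2 fun i => design x i j)

/-- The Euclidean orthogonal projection of `y` on the span of the columns of the design matrix. -/
def fitted (y : Fin n → ℝ) (x : Fin n → Fin p → ℝ) : Fin n → ℝ :=
  WithLp.ofLp ((colSpan x).starProjection (WithLp.toLp 2 y))

/-- The empirical estimator of `R²`. -/
def RsqHat (y : Fin n → ℝ) (x : Fin n → Fin p → ℝ) : ℝ :=
  varN (fitted y x) / varN y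

/-- The least squares estimator `(XᵗX)⁻¹ Xᵗ y` of `(α₀, …, α_p)`. -/
def alphaHatFull (y : Fin n → ℝ) (x : Fin n → Fin p → ℝ) : Fin (p + 1) → ℝ :=
  ((design x)ᵀ * design x)⁻¹ *ᵥ ((design x)ᵀ *ᵥ y)

/-- The estimated slopes `(α̂₁, …, α̂_p)`. -/
def alphaHat (y : Fin n → ℝ) (x : Fin n → Fin p → ℝ) : Fin p → ℝ :=
  fun j => alphaHatFull y x j.succ

/-- The centred `n × p` matrix with entries `x i j - x̄ j`. -/
def centred (x : Fin n → Fin p → ℝ) : Matrix (Fin n) (Fin p) ℝ :=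
  Matrix.of fun i j => x i j - mean fun i' => x i' j

/-- `θ̂_k = ∑ (yᵢ - ȳ)(x i k - x̄ k) / ∑ (yᵢ - ȳ)²`. -/
def thetaHat (y : Fin n → ℝ) (x : Fin n → Fin p → ℝ) : Fin p → ℝ :=
  fun k => (∑ i, (y i - mean y) * centred x i k) / ∑ i, (y i - mean y) ^ 2

/-- Least squares residuals `ε̂ᵢ`. -/
def epsHat (y : Fin n → ℝ) (x : Fin n → Fin p → ℝ) : Fin n → ℝ :=
  fun i => y i - (design x *ᵥ alphaHatFull y x) i

/-- `ê⁽ᵏ⁾ᵢ = (x i k - x̄ k) - θ̂_k (yᵢ - ȳ)`. -/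
def eHat (y : Fin n → ℝ) (x : Fin n → Fin p → ℝ) (k : Fin p) : Fin n → ℝ :=
  fun i => centred x i k - thetaHat y x k * (y i - mean y)

/-- The empirical counterpart of `matA`. -/
def matAHat (y : Fin n → ℝ) (x : Fin n → Fin p → ℝ) :
    Matrix (Fin p ⊕ Fin p) (Fin p ⊕ Fin p) ℝ :=
  let A₁₂ : Matrix (Fin p) (Fin p) ℝ := Matrix.of fun j k =>
    (1 / (n : ℝ)) * ∑ i, centred x i j * (y i - mean y) * epsHat y x i * eHat y x k i
  Matrix.fromBlocks
    (Matrix.of fun j k => (1 / (n : ℝ)) * ∑ i, centred x i j * centred x i k * epsHat y x i ^ 2)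
    A₁₂
    A₁₂ᵀ
    (Matrix.of fun j k =>
      (1 / (n : ℝ)) * ∑ i, (y i - mean y) ^ 2 * eHat y x j i * eHat y x k i)

/-- The empirical counterpart of `matB`. -/
def matBHat (y : Fin n → ℝ) (x : Fin n → Fin p → ℝ) :
    Matrix (Fin p ⊕ Fin p) (Fin p ⊕ Fin p) ℝ :=
  Matrix.fromBlocks ((n : ℝ) • ((centred x)ᵀ * centred x)⁻¹) 0 0
    ((varN y)⁻¹ • (1 : Matrix (Fin p) (Fin p) ℝ))

/-- The estimator `V̂_n = (θ̂, α̂) B̂ Â B̂ (θ̂, α̂)ᵗ`. -/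
def asympVarHat (y : Fin n → ℝ) (x : Fin n → Fin p → ℝ) : ℝ :=
  let v : Fin p ⊕ Fin p → ℝ := Sum.elim (thetaHat y x) (alphaHat y x)
  v ⬝ᵥ ((matBHat y x * matAHat y x * matBHat y x) *ᵥ v)

/-- The quantile of order `q` of the standard normal distribution. -/
def normalQuantile (q : ℝ) : ℝ := sInf {t : ℝ | q ≤ cdf (gaussianReal 0 1) t}

/-- The interval `[R̂² ± c_{1-δ/2} √V̂_n / √n]`. -/
def confInterval (δ : ℝ) (y : Fin n → ℝ) (x : Fin n → Fin p → ℝ) : Set ℝ :=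
  Set.Icc
    (RsqHat y x - normalQuantile (1 - δ / 2) * √(asympVarHat y x) / √(n : ℝ))
    (RsqHat y x + normalQuantile (1 - δ / 2) * √(asympVarHat y x) / √(n : ℝ))

end Sample

end

end MultipleCorrelation

namespace MultipleCorrelation

/-! ### The normal quantile -/

/-! The normal equations give `R² = ∑ α_k θ_k` in the population (`Rsq_eq`) and, once the empirical
covariance matrix `Ĉ` is invertible, `R̂² = ∑ α̂_k θ̂_k` in the sample (`RsqHat_eq`). The difference
is linearized exactly, with no Taylor remainder: `α̂_k θ̂_k - α_k θ_k = θ̂_k (α̂_k - α_k) + α_k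
(θ̂_k - θ_k)`. Here `α̂ - α` is `Ĉ⁻¹` applied to empirical means of regressor times residual, and
`θ̂_k - θ_k` is `Var_n(Y)⁻¹` times a similar mean (`RsqHat_sub`). Passing from empirical to
population centring only adds products of a mean tending to `0` with another centred mean
(`mean_mul_sub_mean`).

After multiplication by `√n`, each error term is a factor tending to `0` in probability times a
normalized mean that is tight by Chebyshev. Hence `√n (R̂² - R²)` is, up to `o_P(1)`, the normalized
sum of one scalar function of the observations, the influence function
(`tendsto_sqrt_mul_RsqHat_sub`). It has mean `0` by orthogonality of the residuals and second moment
`V` (`asympVar_eq`), so the one-dimensional central limit theorem suffices.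

For `V̂_n → V` (`tendsto_asympVarHat`), the entries of `Â` are empirical means of products of four
affine functions of the observations with convergent random coefficients. Expanding reduces their
convergence to the law of large numbers for moments of order at most four (`tendsto_mean_mul₄`).
Slutsky's argument is a sandwich between events on the normalized sum
(`tendsto_measureReal_of_tendstoInDistribution`).

Convergence in probability is expressed by the filter `inProb`, so continuous mapping, matrix
inversion and "invertible with probability tending to one" become ordinary `Tendsto` and
`Eventually` statements. -/

theorem continuous_cdf_gaussianReal : Continuous (cdf (gaussianReal 0 1)) := by
  have : NullSingletonClass (gaussianReal 0 1) := nullSingletonClass_gaussianReal one_ne_zero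
  refine continuous_iff_continuousAt.2 fun a => ?_
  rw [(monotone_cdf (gaussianReal 0 1)).continuousAt_iff_leftLim_eq_rightLim,
    StieltjesFunction.rightLim_eq]
  have h : (cdf (gaussianReal 0 1)).measure {a} = 0 := by
    rw [measure_cdf]; exact measure_singleton a
  rw [StieltjesFunction.measure_singleton, ENNReal.ofReal_eq_zero] at h
  exact le_antisymm ((monotone_cdf (gaussianReal 0 1)).leftLim_le le_rfl) (by linarith)

theorem cdf_gaussianReal_neg (r : ℝ) :
    cdf (gaussianReal 0 1) (-r) = 1 - cdf (gaussianReal 0 1) r := by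
  have : NullSingletonClass (gaussianReal 0 1) := nullSingletonClass_gaussianReal one_ne_zero
  have h1 : (gaussianReal 0 1).real (Set.Iic (-r)) = (gaussianReal 0 1).real (Set.Ici r) := by
    conv_lhs => rw [← neg_zero (G := ℝ), ← gaussianReal_map_neg]
    rw [map_measureReal_apply measurable_neg measurableSet_Iic]
    congr 1
    ext x
    simp
  have h2 : (gaussianReal 0 1).real (Set.Ici r) = (gaussianReal 0 1).real (Set.Ioi r) :=
    measureReal_congr Ioi_ae_eq_Ici.symm
  rw [cdf_eq_real, cdf_eq_real, h1, h2, ← Set.compl_Iic,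
    probReal_compl_eq_one_sub measurableSet_Iic]

theorem gaussianReal_real_Icc {r : ℝ} (hr : 0 ≤ r) :
    (gaussianReal 0 1).real (Set.Icc (-r) r) = 2 * cdf (gaussianReal 0 1) r - 1 := by
  have h : (gaussianReal 0 1) (Set.Icc (-r) r) =
      ENNReal.ofReal (2 * cdf (gaussianReal 0 1) r - 1) := by
    conv_lhs => rw [← measure_cdf (gaussianReal 0 1)]
    rw [StieltjesFunction.measure_Icc,
      continuous_cdf_gaussianReal.continuousAt.continuousWithinAt.leftLim_eq, cdf_gaussianReal_neg]
    ring_nf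
  rw [measureReal_def, h, ENNReal.toReal_ofReal]
  have := monotone_cdf (gaussianReal 0 1) (by linarith : -r ≤ r)
  rw [cdf_gaussianReal_neg] at this
  linarith

/-- Continuity and the limits at infinity produce a point where the cdf equals `q`, which bounds the
infimum above; closedness of the superlevel set shows that the infimum belongs to it. -/
theorem cdf_normalQuantile {q : ℝ} (hq : q ∈ Set.Ioo (0 : ℝ) 1) :
    cdf (gaussianReal 0 1) (normalQuantile q) = q := by
  obtain ⟨t, ht⟩ : q ∈ Set.range (cdf (gaussianReal 0 1)) := by
    obtain ⟨a, ha⟩ := ((tendsto_cdf_atBot (gaussianReal 0 1)).eventually_lt_const hq.1).exists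
    obtain ⟨b, hb⟩ := ((tendsto_cdf_atTop (gaussianReal 0 1)).eventually_const_lt hq.2).exists
    exact mem_range_of_exists_le_of_exists_ge continuous_cdf_gaussianReal ⟨a, ha.le⟩ ⟨b, hb.le⟩
  have hbdd : BddBelow {t : ℝ | q ≤ cdf (gaussianReal 0 1) t} := by
    obtain ⟨a, ha⟩ := ((tendsto_cdf_atBot (gaussianReal 0 1)).eventually_lt_const hq.1).exists
    refine ⟨a, fun s hs => ?_⟩
    by_contra! h
    exact absurd (hs.trans (monotone_cdf _ h.le)) (not_le.2 ha)
  refine le_antisymm ?_ ?_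
  · exact (monotone_cdf _ (csInf_le hbdd ht.symm.le)).trans ht.le
  · have hcl : IsClosed {t : ℝ | q ≤ cdf (gaussianReal 0 1) t} :=
      isClosed_le continuous_const continuous_cdf_gaussianReal
    exact hcl.csInf_mem ⟨t, ht.symm.le⟩ hbdd

theorem cdf_gaussianReal_zero : cdf (gaussianReal 0 1) 0 = 1 / 2 := by
  have := cdf_gaussianReal_neg 0
  rw [neg_zero] at this
  linarith

theorem normalQuantile_pos {q : ℝ} (hq : q ∈ Set.Ioo (1 / 2 : ℝ) 1) : 0 < normalQuantile q := by
  by_contra! h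
  have h1 := monotone_cdf (gaussianReal 0 1) h
  rw [cdf_normalQuantile ⟨by linarith [hq.1], hq.2⟩, cdf_gaussianReal_zero] at h1
  linarith [hq.1]

theorem gaussianReal_real_Icc_normalQuantile {δ : ℝ} (hδ : δ ∈ Set.Ioo (0 : ℝ) 1) :
    (gaussianReal 0 1).real
      (Set.Icc (-normalQuantile (1 - δ / 2)) (normalQuantile (1 - δ / 2))) = 1 - δ := by
  have h : 1 - δ / 2 ∈ Set.Ioo (1 / 2 : ℝ) 1 := ⟨by linarith [hδ.2], by linarith [hδ.1]⟩
  rw [gaussianReal_real_Icc (normalQuantile_pos h).le,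
    cdf_normalQuantile ⟨by linarith [h.1], h.2⟩]
  ring

/-! ### Convergence in probability as convergence along a filter -/

section InProb

variable {Ω : Type*} [MeasurableSpace Ω]

/-- The filter on `ℕ × Ω` of the sets whose sections have complements of outer measure tending
to `0`. A map tends to a constant along this filter iff it converges to it in probability. -/
def inProb (P : Measure Ω) : Filter (ℕ × Ω) where
  sets := {S | Tendsto (fun n => P {ω | (n, ω) ∉ S}) atTop (𝓝 0)}
  univ_sets := by simp
  sets_of_superset {S T} hS hST :=
    tendsto_of_tendsto_of_tendsto_of_le_of_le tendsto_const_nhds hS (fun _ => zero_le)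
      (fun _ => measure_mono fun _ h h' => h (hST h'))
  inter_sets {S T} hS hT := by
    have h := Tendsto.add (show Tendsto _ _ _ from hS) (show Tendsto _ _ _ from hT)
    rw [add_zero] at h
    refine tendsto_of_tendsto_of_tendsto_of_le_of_le tendsto_const_nhds h (fun _ => zero_le)
      (fun n => (measure_mono ?_).trans (measure_union_le _ _))
    intro ω hω
    by_contra h'
    simp only [Set.mem_union, Set.mem_ofPred_eq, not_or, not_not] at h'
    exact hω h'

theorem mem_inProb {P : Measure Ω} {S : Set (ℕ × Ω)} :
    S ∈ inProb P ↔ Tendsto (fun n => P {ω | (n, ω) ∉ S}) atTop (𝓝 0) := Iff.rfl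

theorem tendsto_fst_inProb (P : Measure Ω) : Tendsto Prod.fst (inProb P) atTop := by
  refine tendsto_atTop.2 fun N => mem_inProb.2 ?_
  refine tendsto_const_nhds.congr' ?_
  filter_upwards [eventually_ge_atTop N] with n hn
  simp [hn]

theorem tendsto_inProb_of_tendstoInMeasure {P : Measure Ω} {f : ℕ → Ω → ℝ} {c : ℝ}
    (h : TendstoInMeasure P f atTop fun _ => c) :
    Tendsto (fun q : ℕ × Ω => f q.1 q.2) (inProb P) (𝓝 c) := by
  refine Metric.tendsto_nhds.2 fun ε hε => mem_inProb.2 ?_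
  refine (h (ENNReal.ofReal ε) (by simpa using hε)).congr fun n => ?_
  congr 1
  ext ω
  simp [edist_dist, ENNReal.ofReal_le_ofReal_iff dist_nonneg]

/-- The product of a sequence converging to `0` in probability and of a tight sequence converges
to `0` in probability. -/
theorem tendsto_mul_zero_of_tight {P : Measure Ω} {a T : ℕ × Ω → ℝ} {C : ℝ}
    (ha : Tendsto a (inProb P) (𝓝 0))
    (hT : ∀ K : ℝ, 0 < K → ∀ n, P {ω | K ≤ |T (n, ω)|} ≤ ENNReal.ofReal (C / K ^ 2)) :
    Tendsto (fun q => a q * T q) (inProb P) (𝓝 0) := by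
  refine Metric.tendsto_nhds.2 fun ε hε => mem_inProb.2 ?_
  refine ENNReal.tendsto_nhds_zero.2 fun η hη => ?_
  -- `|aT| ≥ ε` forces `|a| ≥ ε / K` or `|T| ≥ K`. The level `K` is fixed first, making the second
  -- event small uniformly in `n`.
  obtain ⟨K, hK0, hK⟩ : ∃ K : ℝ, 0 < K ∧ ENNReal.ofReal (C / K ^ 2) ≤ η / 2 := by
    have h : Tendsto (fun K : ℝ => ENNReal.ofReal (C / K ^ 2)) atTop (𝓝 0) := by
      rw [← ENNReal.ofReal_zero]
      exact ENNReal.tendsto_ofReal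
        (tendsto_const_nhds.div_atTop (tendsto_pow_atTop two_ne_zero))
    exact ((eventually_gt_atTop 0).and
      (ENNReal.tendsto_nhds_zero.1 h (η / 2) (ENNReal.half_pos hη.ne'))).exists
  have h1 := mem_inProb.1 (Metric.tendsto_nhds.1 ha (ε / K) (by positivity))
  filter_upwards [ENNReal.tendsto_nhds_zero.1 h1 (η / 2) (ENNReal.half_pos hη.ne')] with n hn
  calc P {ω | (n, ω) ∉ {q | dist (a q * T q) 0 < ε}}
      ≤ P ({ω | (n, ω) ∉ {q | dist (a q) 0 < ε / K}} ∪ {ω | K ≤ |T (n, ω)|}) := by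
        refine measure_mono fun ω hω => ?_
        by_contra h
        simp only [Set.mem_union, Set.mem_ofPred_eq, not_or, not_le, dist_zero_right,
          Real.norm_eq_abs, not_lt] at h hω
        rw [abs_mul] at hω
        have := mul_lt_mul'' h.1 h.2 (abs_nonneg _) (abs_nonneg _)
        rw [div_mul_cancel₀ _ hK0.ne'] at this
        linarith
    _ ≤ η / 2 + η / 2 := (measure_union_le _ _).trans (add_le_add hn ((hT K hK0 n).trans hK))
    _ = η := ENNReal.add_halves η

/-- If `T n` converges in distribution to a standard normal variable, then events that are
asymptotically of the form `|T n + o(1)| ≤ c + o(1)` have the limiting normal probability. -/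
theorem tendsto_measureReal_of_tendstoInDistribution {P : Measure Ω} [IsProbabilityMeasure P]
    {T : ℕ → Ω → ℝ} (hT : TendstoInDistribution T atTop id (fun _ => P) (gaussianReal 0 1))
    {c : ℝ} (hc : 0 < c) {S : ℕ → Set Ω} {D Q : ℕ × Ω → ℝ}
    (hD : Tendsto (fun q => D q - T q.1 q.2) (inProb P) (𝓝 0))
    (hQ : Tendsto Q (inProb P) (𝓝 c))
    (hS : ∀ᶠ q in inProb P, (q.2 ∈ S q.1 ↔ |D q| ≤ Q q)) :
    Tendsto (fun n => P.real (S n)) atTop (𝓝 ((gaussianReal 0 1).real (Set.Icc (-c) c))) := by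
  have : NullSingletonClass (gaussianReal 0 1) := nullSingletonClass_gaussianReal one_ne_zero
  have hI : ∀ r : ℝ, 0 ≤ r → Tendsto (fun n => P.real {ω | |T n ω| ≤ r}) atTop
      (𝓝 ((gaussianReal 0 1).real (Set.Icc (-r) r))) := by
    intro r hr
    have h := ProbabilityMeasure.tendsto_measure_of_null_frontier_of_tendsto' hT.tendsto
      (E := Set.Icc (-r) r) (by
        change (Measure.map id (gaussianReal 0 1)) _ = 0
        rw [Measure.map_id, frontier_Icc (by linarith)]
        exact (Set.toFinite _).measure_zero _)
    simp only [ProbabilityMeasure.coe_mk, Measure.map_id] at h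
    have h' := (ENNReal.tendsto_toReal (measure_ne_top (gaussianReal 0 1) _)).comp h
    refine h'.congr fun n => ?_
    simp only [Function.comp]
    rw [Measure.map_apply_of_aemeasurable (hT.forall_aemeasurable n) measurableSet_Icc,
      measureReal_def]
    congr 2
    ext ω
    simp [abs_le]
  have hG : ContinuousAt (fun r => 2 * cdf (gaussianReal 0 1) r - 1) c :=
    ((continuous_cdf_gaussianReal.const_mul 2).sub continuous_const).continuousAt
  rw [gaussianReal_real_Icc hc.le]
  refine Metric.tendsto_nhds.2 fun ε hε => ?_
  obtain ⟨η₀, hη₀, hη₀G⟩ := Metric.continuousAt_iff.1 hG (ε / 3) (by positivity)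
  -- The first bound keeps `c ± η` within the continuity window `η₀`; the second keeps `c - η`
  -- positive, where the formula for symmetric intervals applies.
  set η := min (η₀ / 2) (c / 2) with hη
  have hηpos : 0 < η := by positivity
  have hηlt : η < η₀ := (min_le_left _ _).trans_lt (by linarith)
  have hηc : η ≤ c / 2 := min_le_right _ _
  have hup := hη₀G (x := c + η) (by simpa [Real.dist_eq, abs_of_pos hηpos] using hηlt)
  have hlo := hη₀G (x := c - η) (by simpa [Real.dist_eq, abs_of_pos hηpos] using hηlt)
  rw [← gaussianReal_real_Icc (by linarith)] at hup hlo
  have hup' := Metric.tendsto_nhds.1 (hI (c + η) (by linarith)) (ε / 3) (by positivity)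
  have hlo' := Metric.tendsto_nhds.1 (hI (c - η) (by linarith)) (ε / 3) (by positivity)
  have hgood := hS.and ((Metric.tendsto_nhds.1 hD (η / 2) (by positivity)).and
    (Metric.tendsto_nhds.1 hQ (η / 2) (by positivity)))
  have hbad := (ENNReal.tendsto_toReal ENNReal.zero_ne_top).comp (mem_inProb.1 hgood)
  have hbad' := Metric.tendsto_nhds.1 hbad (ε / 3) (by positivity)
  filter_upwards [hup', hlo', hbad'] with n h1 h2 h3
  set B := {ω | (n, ω) ∉ {q : ℕ × Ω | (q.2 ∈ S q.1 ↔ |D q| ≤ Q q) ∧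
    dist (D q - T q.1 q.2) 0 < η / 2 ∧ dist (Q q) c < η / 2}} with hB
  have hB' : P.real B < ε / 3 := by
    have : |P.real B - 0| < ε / 3 := h3
    rw [sub_zero] at this
    exact (le_abs_self _).trans_lt this
  -- Off `B`, the errors of `D` and of `Q` are each below `η / 2`, so `S n` lies between the events
  -- `|T n| ≤ c - η` and `|T n| ≤ c + η`.
  have hsub1 : S n ⊆ {ω | |T n ω| ≤ c + η} ∪ B := by
    intro ω hω
    by_contra h
    simp only [hB, Set.mem_union, Set.mem_ofPred_eq, not_or, not_not, not_le, Real.dist_eq,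
      sub_zero] at h
    obtain ⟨ha, hb, hc', hd⟩ := h
    have he := hb.1 hω
    rw [abs_lt] at hc' hd
    rw [abs_le] at he
    rw [lt_abs] at ha
    rcases ha with ha | ha <;> linarith
  have hsub2 : {ω | |T n ω| ≤ c - η} ⊆ S n ∪ B := by
    intro ω hω
    by_contra h
    simp only [hB, Set.mem_union, Set.mem_ofPred_eq, not_or, not_not, Real.dist_eq,
      sub_zero] at h hω
    obtain ⟨ha, hb, hc', hd⟩ := h
    refine ha (hb.2 ?_)
    rw [abs_lt] at hc' hd
    rw [abs_le] at hω ⊢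
    constructor <;> linarith
  have hm1 := (measureReal_mono (μ := P) hsub1).trans (measureReal_union_le _ _)
  have hm2 := (measureReal_mono (μ := P) hsub2).trans (measureReal_union_le _ _)
  rw [Real.dist_eq, abs_lt] at *
  constructor <;> linarith

/-! ### Limit theorems for functions of independent copies -/

variable {Ω₀ E : Type*} [MeasurableSpace Ω₀] [MeasurableSpace E] {P₀ : Measure Ω₀}
  {P : Measure Ω} {W : ℕ → Ω → E} {W₀ : Ω₀ → E}

theorem tendsto_mean_inProb [IsProbabilityMeasure P] (hind : iIndepFun W P)
    (hid : ∀ i, IdentDistrib (W i) W₀ P P₀) {f : E → ℝ} (hf : Measurable f)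
    (hint : Integrable (fun ω => f (W₀ ω)) P₀) :
    Tendsto (fun q : ℕ × Ω => mean fun i : Fin q.1 => f (W i q.2)) (inProb P)
      (𝓝 (∫ ω, f (W₀ ω) ∂P₀)) := by
  have hid' : ∀ i, IdentDistrib (fun ω => f (W i ω)) (fun ω => f (W₀ ω)) P P₀ :=
    fun i => (hid i).comp hf
  have hae := strong_law_ae_real (fun i ω => f (W i ω)) ((hid' 0).integrable_iff.2 hint)
    (fun i j hij => (hind.indepFun hij).comp hf hf) (fun i => (hid' i).trans (hid' 0).symm)
  have hmeas : ∀ n : ℕ, AEStronglyMeasurable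
      (fun ω => (∑ i ∈ Finset.range n, f (W i ω)) / n) P := fun n =>
    ((Finset.aemeasurable_fun_sum _ fun i _ =>
      (hid' i).aemeasurable_fst).div_const _).aestronglyMeasurable
  have h := tendsto_inProb_of_tendstoInMeasure (tendstoInMeasure_of_tendsto_ae hmeas hae)
  rw [(hid' 0).integral_eq] at h
  refine h.congr fun q => ?_
  simp only [mean]
  rw [Fin.sum_univ_eq_sum_range (fun i => f (W i q.2))]
  ring

theorem sqrt_mul_mean (n : ℕ) (z : ℕ → ℝ) :
    √(n : ℝ) * mean (fun i : Fin n => z i) = (√(n : ℝ))⁻¹ * ∑ i ∈ Finset.range n, z i := by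
  simp only [mean]
  rw [Fin.sum_univ_eq_sum_range z, ← mul_assoc]
  congr 1
  rcases Nat.eq_zero_or_pos n with rfl | hn
  · simp
  · have h : 0 < √(n : ℝ) := Real.sqrt_pos.2 (by exact_mod_cast hn)
    have h2 : √(n : ℝ) * √(n : ℝ) = n := Real.mul_self_sqrt (by positivity)
    rw [← h2]
    field_simp
    rw [Real.sqrt_sq h.le]

/-- Chebyshev: the normalized sum has the variance of a single term for every `n > 0` and variance
`0` for `n = 0`. The bound is uniform in `n`, as `tendsto_mul_zero_of_tight` requires. -/
theorem measure_sqrt_mul_mean_ge [IsProbabilityMeasure P] (hind : iIndepFun W P)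
    (hid : ∀ i, IdentDistrib (W i) W₀ P P₀) {f : E → ℝ} (hf : Measurable f)
    (h2 : MemLp (fun ω => f (W₀ ω)) 2 P₀) (h0 : ∫ ω, f (W₀ ω) ∂P₀ = 0) (K : ℝ) (hK : 0 < K)
    (n : ℕ) :
    P {ω | K ≤ |√(n : ℝ) * mean (fun i : Fin n => f (W i ω))|} ≤
      ENNReal.ofReal (Var[fun ω => f (W₀ ω); P₀] / K ^ 2) := by
  have hid' : ∀ i, IdentDistrib (fun ω => f (W i ω)) (fun ω => f (W₀ ω)) P P₀ :=
    fun i => (hid i).comp hf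
  have hL : ∀ i, MemLp (fun ω => f (W i ω)) 2 P := fun i => (hid' i).memLp_iff.2 h2
  have hsum : MemLp (fun ω => ∑ i ∈ Finset.range n, f (W i ω)) 2 P :=
    memLp_finsetSum _ fun i _ => hL i
  have hmean : ∫ ω, (√(n : ℝ))⁻¹ * ∑ i ∈ Finset.range n, f (W i ω) ∂P = 0 := by
    rw [integral_const_mul, integral_finsetSum _ fun i _ => (hL i).integrable one_le_two]
    simp [(hid' _).integral_eq, h0]
  have hvar : Var[fun ω => (√(n : ℝ))⁻¹ * ∑ i ∈ Finset.range n, f (W i ω); P] ≤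
      Var[fun ω => f (W₀ ω); P₀] := by
    rw [variance_const_mul]
    have : Var[fun ω => ∑ i ∈ Finset.range n, f (W i ω); P] =
        n * Var[fun ω => f (W₀ ω); P₀] := by
      have h := IndepFun.variance_sum (X := fun i ω => f (W i ω)) (s := Finset.range n)
        (fun i _ => hL i) (fun i _ j _ hij => (hind.indepFun hij).comp hf hf)
      rw [Finset.sum_congr rfl fun i _ => (hid' i).variance_eq] at h
      rw [← Finset.sum_fn, h]
      simp
    rw [this, inv_pow, Real.sq_sqrt (Nat.cast_nonneg _)]
    rcases Nat.eq_zero_or_pos n with rfl | hn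
    · simp [variance_nonneg]
    · rw [inv_mul_cancel_left₀ (by positivity)]
  have hcheb := meas_ge_le_variance_div_sq (hsum.const_mul (√(n : ℝ))⁻¹) hK
  rw [hmean] at hcheb
  simp only [sub_zero] at hcheb
  refine le_trans (measure_mono fun ω hω => ?_) (hcheb.trans ?_)
  · simpa only [Set.mem_ofPred_eq, sqrt_mul_mean n fun i => f (W i ω)] using hω
  · exact ENNReal.ofReal_le_ofReal (by gcongr)

theorem tendstoInDistribution_sqrt_mul_mean [IsProbabilityMeasure P] (hind : iIndepFun W P)
    (hid : ∀ i, IdentDistrib (W i) W₀ P P₀) {f : E → ℝ} (hf : Measurable f)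
    (h0 : ∫ ω, f (W₀ ω) ∂P₀ = 0) {v : ℝ} (hv : 0 < v) (h2 : ∫ ω, f (W₀ ω) ^ 2 ∂P₀ = v) :
    TendstoInDistribution (fun (n : ℕ) ω => √(n : ℝ) * mean (fun i : Fin n => f (W i ω)) / √v)
      atTop id (fun _ => P) (gaussianReal 0 1) := by
  have hg : Measurable fun x => f x / √v := hf.div_const _
  have hid' : ∀ i, IdentDistrib (fun ω => f (W i ω) / √v) (fun ω => f (W₀ ω) / √v) P P₀ :=
    fun i => (hid i).comp hg
  have h := tendstoInDistribution_inv_sqrt_mul_sum (X := fun i ω => f (W i ω) / √v) (P := P)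
    (Y := id) (P' := gaussianReal 0 1) ⟨aemeasurable_id, Measure.map_id⟩ ?_ ?_
    (hind.comp _ fun _ => hg) (fun i => (hid' i).trans (hid' 0).symm)
  · convert! h using 3 with n ω
    rw [sqrt_mul_mean n fun i => f (W i ω), ← Finset.sum_div, mul_div_assoc]
  · rw [(hid' 0).integral_eq, integral_div, h0, zero_div]
  · have hsq := (hid' 0).comp (measurable_id.pow_const 2)
    have := hsq.integral_eq
    simp only [Function.comp_def, id] at this
    simp only [Pi.pow_apply]
    rw [this]
    simp only [div_pow, Real.sq_sqrt hv.le]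
    rw [integral_div, h2, div_self hv.ne']

end InProb

/-! ### Least squares algebra of a finite sample. -/

section SampleAlgebra

variable {n p : ℕ}

theorem mean_add (z w : Fin n → ℝ) : mean (fun i => z i + w i) = mean z + mean w := by
  simp only [mean, Finset.sum_add_distrib, mul_add]

theorem mean_sub (z w : Fin n → ℝ) : mean (fun i => z i - w i) = mean z - mean w := by
  simp only [mean, Finset.sum_sub_distrib, mul_sub]

theorem mean_const_mul (c : ℝ) (z : Fin n → ℝ) : mean (fun i => c * z i) = c * mean z := by
  simp only [mean, ← Finset.mul_sum]
  ring

theorem mean_sum {ι : Type*} (s : Finset ι) (z : ι → Fin n → ℝ) :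
    mean (fun i => ∑ a ∈ s, z a i) = ∑ a ∈ s, mean (z a) := by
  simp only [mean]
  rw [Finset.sum_comm, Finset.mul_sum]

theorem mean_const (hn : n ≠ 0) (c : ℝ) : mean (fun _ : Fin n => c) = c := by
  have : (n : ℝ) ≠ 0 := by exact_mod_cast hn
  simp [mean, this]

theorem mean_sub_mean (z : Fin n → ℝ) : mean (fun i => z i - mean z) = 0 := by
  rcases eq_or_ne n 0 with rfl | hn
  · simp [mean]
  · rw [mean_sub, mean_const hn, sub_self]

/-- Trades empirical centring for centring at fixed constants. At the population means the
correction is a product of two quantities tending to `0`, hence negligible after scaling by `√n`. -/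
theorem mean_mul_sub_mean (z w : Fin n → ℝ) (s t : ℝ) :
    mean (fun i => (z i - mean z) * (w i - mean w)) =
      mean (fun i => (z i - s) * (w i - t)) - (mean z - s) * mean (fun i => w i - t) := by
  have h : (fun i => (z i - mean z) * (w i - mean w)) = fun i =>
      (z i - s) * (w i - t) - ((mean z - s) * (w i - t) + (mean w - t) * (z i - mean z)) := by
    ext i; ring
  rw [h, mean_sub, mean_add, mean_const_mul, mean_const_mul, mean_sub_mean]
  ring

/-- The empirical covariance matrix. -/
noncomputable def covHat (x : Fin n → Fin p → ℝ) : Matrix (Fin p) (Fin p) ℝ :=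
  Matrix.of fun j k => mean fun i => centred x i j * centred x i k

/-- The empirical covariances of the response with the regressors. -/
noncomputable def crossCovHat (y : Fin n → ℝ) (x : Fin n → Fin p → ℝ) : Fin p → ℝ :=
  fun k => mean fun i => (y i - mean y) * centred x i k

theorem covHat_eq (x : Fin n → Fin p → ℝ) :
    covHat x = (1 / (n : ℝ)) • ((centred x)ᵀ * centred x) := by
  ext j k
  simp [covHat, mean, Matrix.mul_apply]

theorem smul_inv_eq_covHat_inv (hn : n ≠ 0) (x : Fin n → Fin p → ℝ) :
    (n : ℝ) • ((centred x)ᵀ * centred x)⁻¹ = (covHat x)⁻¹ := by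
  have hn' : (n : ℝ) ≠ 0 := by exact_mod_cast hn
  have h : (centred x)ᵀ * centred x = (n : ℝ) • covHat x := by
    rw [covHat_eq, smul_smul, mul_one_div_cancel hn', one_smul]
  rw [h]
  by_cases hd : IsUnit (covHat x).det
  · have hk : ((n : ℝ) • covHat x)⁻¹ = (n : ℝ)⁻¹ • (covHat x)⁻¹ := by
      refine Matrix.inv_eq_left_inv ?_
      rw [Matrix.smul_mul, Matrix.mul_smul, smul_smul, Matrix.nonsing_inv_mul _ hd,
        inv_mul_cancel₀ hn', one_smul]
    rw [hk, smul_smul, mul_inv_cancel₀ hn', one_smul]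
  -- In the singular case both inverses take the default value `0`, so no invertibility hypothesis
  -- is needed.
  · rw [Matrix.nonsing_inv_apply_not_isUnit _ hd, Matrix.nonsing_inv_apply_not_isUnit, smul_zero]
    rw [Matrix.det_smul]
    simpa [hn'] using hd

theorem covHat_transpose (x : Fin n → Fin p → ℝ) : (covHat x)ᵀ = covHat x := by
  ext j k
  simp [covHat, mul_comm]

theorem thetaHat_eq (hn : n ≠ 0) (y : Fin n → ℝ) (x : Fin n → Fin p → ℝ) (k : Fin p) :
    thetaHat y x k = crossCovHat y x k / varN y := by
  have hn' : (n : ℝ) ≠ 0 := by exact_mod_cast hn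
  simp only [thetaHat, crossCovHat, varN, mean]
  rw [mul_div_mul_left _ _ (by positivity)]

theorem design_mulVec (x : Fin n → Fin p → ℝ) (a : Fin (p + 1) → ℝ) (i : Fin n) :
    (design x *ᵥ a) i = a 0 + ∑ j, a j.succ * x i j := by
  simp [Matrix.mulVec, dotProduct, design, Fin.sum_univ_succ, mul_comm]

theorem sum_mul_self_eq_zero_iff (z : Fin n → ℝ) : ∑ i, z i * z i = 0 ↔ z = 0 := by
  rw [Finset.sum_eq_zero_iff_of_nonneg fun i _ => mul_self_nonneg _]
  simp [funext_iff]

/-- A kernel vector of the Gram matrix is killed by the design matrix. Subtracting the average of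
the rows removes the intercept, so the slopes lie in the kernel of `covHat x` and vanish; the
averaged relation then kills the intercept. -/
theorem isUnit_det_gram (hn : n ≠ 0) {x : Fin n → Fin p → ℝ} (hx : IsUnit (covHat x).det) :
    IsUnit ((design x)ᵀ * design x).det := by
  rw [← Matrix.isUnit_iff_isUnit_det, ← Matrix.mulVec_injective_iff_isUnit]
  refine (injective_iff_map_eq_zero (Matrix.mulVecLin ((design x)ᵀ * design x))).2 fun a ha => ?_
  rw [Matrix.mulVecLin_apply] at ha
  have h0 : design x *ᵥ a = 0 := by
    rw [← sum_mul_self_eq_zero_iff]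
    have : a ⬝ᵥ (((design x)ᵀ * design x) *ᵥ a) = 0 := by rw [ha, dotProduct_zero]
    rw [← Matrix.mulVec_mulVec, Matrix.dotProduct_mulVec, Matrix.vecMul_transpose] at this
    exact this
  have h1 : ∀ i, a 0 + ∑ j, a j.succ * x i j = 0 := fun i => by
    rw [← design_mulVec, h0, Pi.zero_apply]
  have h2 : a 0 + ∑ j, a j.succ * mean (fun i => x i j) = 0 := by
    have : mean (fun i => a 0 + ∑ j, a j.succ * x i j) = 0 := by simp [h1, mean]
    rw [mean_add, mean_const hn, mean_sum] at this
    simpa [mean_const_mul] using this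
  have h3 : ∀ i, ∑ j, a j.succ * centred x i j = 0 := fun i => by
    have := h1 i
    simp only [centred, Matrix.of_apply, mul_sub, Finset.sum_sub_distrib]
    linarith
  have h4 : covHat x *ᵥ (fun j => a j.succ) = 0 := by
    ext j
    simp only [Matrix.mulVec, dotProduct, covHat, Matrix.of_apply, Pi.zero_apply]
    calc ∑ k, mean (fun i => centred x i j * centred x i k) * a k.succ
        = mean (fun i => centred x i j * ∑ k, a k.succ * centred x i k) := by
          simp_rw [Finset.mul_sum]
          rw [mean_sum]
          refine Finset.sum_congr rfl fun k _ => ?_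
          rw [mul_comm, ← mean_const_mul]
          congr 1; ext i; ring
      _ = 0 := by simp [h3, mean]
  have h5 : (fun j : Fin p => a j.succ) = 0 := by
    rw [← Matrix.isUnit_iff_isUnit_det, ← Matrix.mulVec_injective_iff_isUnit] at hx
    exact hx (by rw [h4, Matrix.mulVec_zero])
  have h6 : ∀ j : Fin p, a j.succ = 0 := fun j => congrFun h5 j
  ext j
  refine Fin.cases ?_ (fun j => h6 j) j
  simpa [h6] using h2

variable {y : Fin n → ℝ} {x : Fin n → Fin p → ℝ}

theorem transpose_mulVec_epsHat (hn : n ≠ 0) (hx : IsUnit (covHat x).det) :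
    (design x)ᵀ *ᵥ epsHat y x = 0 := by
  have h : epsHat y x = y - design x *ᵥ alphaHatFull y x := rfl
  rw [h, Matrix.mulVec_sub, alphaHatFull, Matrix.mulVec_mulVec, Matrix.mulVec_mulVec,
    Matrix.mul_nonsing_inv _ (isUnit_det_gram hn hx), Matrix.one_mulVec,
    sub_self]

theorem mean_epsHat (hn : n ≠ 0) (hx : IsUnit (covHat x).det) : mean (epsHat y x) = 0 := by
  have h := congrFun (transpose_mulVec_epsHat (y := y) hn hx) 0
  simp only [Matrix.mulVec, dotProduct, Matrix.transpose_apply, design, Matrix.of_apply,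
    Fin.cons_zero, one_mul, Pi.zero_apply] at h
  rw [mean, h, mul_zero]

theorem mean_centred_mul_epsHat (hn : n ≠ 0) (hx : IsUnit (covHat x).det) (j : Fin p) :
    mean (fun i => centred x i j * epsHat y x i) = 0 := by
  have h := congrFun (transpose_mulVec_epsHat (y := y) hn hx) j.succ
  simp only [Matrix.mulVec, dotProduct, Matrix.transpose_apply, design, Matrix.of_apply,
    Fin.cons_succ, Pi.zero_apply] at h
  have h' : mean (fun i => x i j * epsHat y x i) = 0 := by rw [mean, h, mul_zero]
  simp only [centred, Matrix.of_apply, sub_mul]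
  rw [mean_sub, h', mean_const_mul, mean_epsHat hn hx]
  simp

theorem epsHat_eq (hn : n ≠ 0) (hx : IsUnit (covHat x).det) (i : Fin n) :
    epsHat y x i = (y i - mean y) - ∑ j, alphaHat y x j * centred x i j := by
  have h1 : ∀ i, epsHat y x i =
      y i - (alphaHatFull y x 0 + ∑ j, alphaHat y x j * x i j) := fun i => by
    rw [epsHat, design_mulVec]; rfl
  have h2 := mean_epsHat (y := y) hn hx
  rw [show epsHat y x = fun i => y i - (alphaHatFull y x 0 + ∑ j, alphaHat y x j * x i j) from
    funext h1, mean_sub, mean_add, mean_const hn, mean_sum] at h2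
  simp only [mean_const_mul] at h2
  rw [h1]
  simp only [centred, Matrix.of_apply, mul_sub, Finset.sum_sub_distrib]
  linarith

theorem covHat_mulVec (x : Fin n → Fin p → ℝ) (a : Fin p → ℝ) (k : Fin p) :
    (covHat x *ᵥ a) k = mean (fun i => centred x i k * ∑ j, a j * centred x i j) := by
  simp only [Matrix.mulVec, dotProduct, covHat, Matrix.of_apply, Finset.mul_sum]
  rw [mean_sum]
  refine Finset.sum_congr rfl fun j _ => ?_
  rw [mul_comm, ← mean_const_mul]
  congr 1; ext i; ring

/-- Valid for arbitrary slopes: at `alphaHat` the residual term vanishes and the normal equations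
appear, while at the population slopes it is the term that drives `α̂ - α`. -/
theorem covHat_mulVec_add (y : Fin n → ℝ) (x : Fin n → Fin p → ℝ) (a : Fin p → ℝ) (k : Fin p) :
    (covHat x *ᵥ a) k +
      mean (fun i => centred x i k * ((y i - mean y) - ∑ j, a j * centred x i j)) =
      crossCovHat y x k := by
  rw [covHat_mulVec, ← mean_add, crossCovHat]
  congr 1; ext i; ring

theorem covHat_mulVec_alphaHat (hn : n ≠ 0) (hx : IsUnit (covHat x).det) :
    covHat x *ᵥ alphaHat y x = crossCovHat y x := by
  ext k
  rw [← covHat_mulVec_add y x (alphaHat y x) k]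
  simp only [← epsHat_eq hn hx]
  rw [mean_centred_mul_epsHat hn hx, add_zero]

theorem alphaHat_eq (hn : n ≠ 0) (hx : IsUnit (covHat x).det) :
    alphaHat y x = (covHat x)⁻¹ *ᵥ crossCovHat y x := by
  rw [← covHat_mulVec_alphaHat hn hx, Matrix.mulVec_mulVec, Matrix.nonsing_inv_mul _ hx,
    Matrix.one_mulVec]

theorem fitted_eq (hn : n ≠ 0) (hx : IsUnit (covHat x).det) :
    fitted y x = design x *ᵥ alphaHatFull y x := by
  have h : (colSpan x).starProjection (WithLp.toLp 2 y) =
      WithLp.toLp 2 (design x *ᵥ alphaHatFull y x) := by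
    apply Submodule.eq_starProjection_of_mem_of_inner_eq_zero
    · have : WithLp.toLp 2 (design x *ᵥ alphaHatFull y x) = ∑ j, alphaHatFull y x j •
          (WithLp.toLp 2 fun i => design x i j : EuclideanSpace ℝ (Fin n)) := by
        ext i
        simp [Matrix.mulVec, dotProduct, mul_comm]
      rw [this]
      exact Submodule.sum_mem _ fun j _ => Submodule.smul_mem _ _
        (Submodule.subset_span ⟨j, rfl⟩)
    · intro w hw
      induction hw using Submodule.span_induction with
      | mem w hw =>
        obtain ⟨j, rfl⟩ := hw
        have h := congrFun (transpose_mulVec_epsHat (y := y) hn hx) j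
        simp only [Matrix.mulVec, dotProduct, Matrix.transpose_apply, Pi.zero_apply, epsHat] at h
        simpa [PiLp.inner_apply, Matrix.mulVec, dotProduct] using h
      | zero => simp
      | add u v _ _ hu hv => rw [inner_add_right, hu, hv, add_zero]
      | smul c u _ hu => rw [inner_smul_right, hu, mul_zero]
  rw [fitted, h]

/-- Residuals have mean zero, so centred fitted values are the combination of centred regressors
with slopes `α̂`. Their variance `α̂ᵗ Ĉ α̂` becomes linear in `α̂` by the normal equations. -/
theorem RsqHat_eq (hn : n ≠ 0) (hx : IsUnit (covHat x).det) :
    RsqHat y x = ∑ k, alphaHat y x k * thetaHat y x k := by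
  have hf : ∀ i, fitted y x i = y i - epsHat y x i := fun i => by
    rw [fitted_eq hn hx, epsHat]; ring
  have hm : mean (fitted y x) = mean y := by
    rw [show fitted y x = fun i => y i - epsHat y x i from funext hf, mean_sub,
      mean_epsHat hn hx, sub_zero]
  have hc : ∀ i, fitted y x i - mean (fitted y x) = ∑ j, alphaHat y x j * centred x i j :=
    fun i => by
      have := epsHat_eq (y := y) hn hx i
      rw [hf, hm]; linarith
  have hv : varN (fitted y x) = ∑ k, alphaHat y x k * crossCovHat y x k := by
    change mean (fun i => (fitted y x i - mean (fitted y x)) ^ 2) = _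
    simp only [hc, ← covHat_mulVec_alphaHat hn hx, covHat_mulVec, ← mean_const_mul]
    rw [← mean_sum]
    congr 1; ext i
    rw [sq, Finset.sum_mul]
    exact Finset.sum_congr rfl fun j _ => by ring
  rw [RsqHat, hv, Finset.sum_div]
  exact Finset.sum_congr rfl fun k _ => by rw [thetaHat_eq hn, mul_div_assoc]

/-- Exact linearization of the estimator of `R²` around arbitrary coefficients. -/
theorem RsqHat_sub (hn : n ≠ 0) (hx : IsUnit (covHat x).det) (hy : varN y ≠ 0)
    (α θ : Fin p → ℝ) :
    RsqHat y x - ∑ k, α k * θ k =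
      ∑ k, ((covHat x)⁻¹ *ᵥ thetaHat y x) k *
          mean (fun i => centred x i k * ((y i - mean y) - ∑ j, α j * centred x i j)) +
        ∑ k, α k / varN y *
          mean (fun i => (y i - mean y) * (centred x i k - θ k * (y i - mean y))) := by
  set u : Fin p → ℝ := fun k =>
    mean (fun i => centred x i k * ((y i - mean y) - ∑ j, α j * centred x i j)) with hu
  have hα : alphaHat y x - α = (covHat x)⁻¹ *ᵥ u := by
    have : u = covHat x *ᵥ (alphaHat y x - α) := by
      rw [Matrix.mulVec_sub, covHat_mulVec_alphaHat hn hx]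
      ext k
      rw [Pi.sub_apply, ← covHat_mulVec_add y x α k]
      ring
    rw [this, Matrix.mulVec_mulVec, Matrix.nonsing_inv_mul _ hx, Matrix.one_mulVec]
  have hθ : ∀ k, thetaHat y x k - θ k = (varN y)⁻¹ *
      mean (fun i => (y i - mean y) * (centred x i k - θ k * (y i - mean y))) := fun k => by
    have : mean (fun i => (y i - mean y) * (centred x i k - θ k * (y i - mean y))) =
        crossCovHat y x k - θ k * varN y := by
      change _ = _ - θ k * mean (fun i => (y i - mean y) ^ 2)
      rw [crossCovHat, ← mean_const_mul, ← mean_sub]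
      congr 1; ext i; ring
    rw [this, thetaHat_eq hn]
    field_simp
  -- Symmetry of `covHat x` moves the inverse from `θ̂` onto `u`, where it yields `α̂ - α`.
  have hsym : ∑ k, ((covHat x)⁻¹ *ᵥ thetaHat y x) k * u k =
      ∑ k, thetaHat y x k * (alphaHat y x k - α k) := by
    have : ((covHat x)⁻¹ *ᵥ thetaHat y x) ⬝ᵥ u = thetaHat y x ⬝ᵥ ((covHat x)⁻¹ *ᵥ u) := by
      rw [Matrix.dotProduct_mulVec, ← Matrix.mulVec_transpose, Matrix.transpose_nonsing_inv,
        covHat_transpose]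
    rw [← hα] at this
    exact this
  rw [RsqHat_eq hn hx, hsym, ← Finset.sum_sub_distrib, ← Finset.sum_add_distrib]
  refine Finset.sum_congr rfl fun k _ => ?_
  have := hθ k
  rw [div_mul_eq_mul_div, mul_div_assoc, div_eq_inv_mul, ← this]
  ring

end SampleAlgebra

/-! ### Projections, residuals and the influence function in the population. -/

section PopulationFacts

theorem sum_withConst {Ω : Type*} {p : ℕ} {X : Fin p → Ω → ℝ} (a : Fin (p + 1) → ℝ)
    (ω : Ω) :
    ∑ j, a j * withConst X j ω = a 0 + ∑ j, a j.succ * X j ω := by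
  simp [Fin.sum_univ_succ, withConst]

variable {Ω : Type*} [MeasurableSpace Ω] {P : Measure Ω}

theorem memLp_two_mul {f g : Ω → ℝ} (hf : MemLp f 4 P) (hg : MemLp g 4 P) :
    MemLp (fun ω => f ω * g ω) 2 P := by
  have : ENNReal.HolderTriple 4 4 2 := ⟨by
    rw [← two_mul, show (4 : ENNReal) = 2 * 2 by norm_num,
      ENNReal.mul_inv (by simp) (by simp), ← mul_assoc,
      ENNReal.mul_inv_cancel (by simp) (by simp), one_mul]⟩
  exact hg.mul' hf

theorem integrable_mul₄ {f g h k : Ω → ℝ} (hf : MemLp f 4 P) (hg : MemLp g 4 P)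
    (hh : MemLp h 4 P) (hk : MemLp k 4 P) :
    Integrable (fun ω => f ω * g ω * h ω * k ω) P := by
  have := (memLp_two_mul hf hg).integrable_mul (memLp_two_mul hh hk)
  refine this.congr (ae_of_all _ fun ω => ?_)
  simp only [Pi.mul_apply]
  ring

section Projection

variable {m : ℕ} {U : Fin m → Ω → ℝ} {Z : Ω → ℝ}

theorem toL2_eq {f : Ω → ℝ} (hf : MemLp f 2 P) : toL2 P f = hf.toLp f := dif_pos hf

theorem coeFn_sum_smul_toL2 (hU : ∀ j, MemLp (U j) 2 P) (b : Fin m → ℝ) :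
    (∑ j, b j • toL2 P (U j) : Lp ℝ 2 P) =ᵐ[P] fun ω => ∑ j, b j * U j ω := by
  have h : (∑ j, b j • toL2 P (U j) : Lp ℝ 2 P) =
      (memLp_finsetSum Finset.univ fun j _ => (hU j).const_mul (b j)).toLp
        (fun ω => ∑ j, b j * U j ω) := by
    have h1 : ∀ j, b j • toL2 P (U j) = ((hU j).const_mul (b j)).toLp (fun ω => b j * U j ω) :=
      fun j => by
        rw [toL2_eq (hU j), ← MemLp.toLp_const_smul]; rfl
    simp only [h1]
    rw [Lp.ext_iff]
    refine EventuallyEq.trans ?_ (MemLp.coeFn_toLp _).symm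
    refine (Lp.coeFn_finsetSum _ _).trans ?_
    have h2 := ae_all_iff.2 fun j => ((hU j).const_mul (b j)).coeFn_toLp
    filter_upwards [h2] with ω hω
    rw [Finset.sum_apply]
    exact Finset.sum_congr rfl fun j _ => hω j
  rw [h]
  exact MemLp.coeFn_toLp _

theorem inner_sub_sum_smul_toL2 (hU : ∀ j, MemLp (U j) 2 P) (hZ : MemLp Z 2 P) (b : Fin m → ℝ)
    (j : Fin m) :
    inner ℝ (toL2 P Z - ∑ j, b j • toL2 P (U j)) (toL2 P (U j)) =
      ∫ ω, (Z ω - ∑ i, b i * U i ω) * U j ω ∂P := by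
  rw [L2.inner_def]
  refine integral_congr_ae ?_
  have h1 : toL2 P Z =ᵐ[P] Z := by rw [toL2_eq hZ]; exact hZ.coeFn_toLp
  have h2 : toL2 P (U j) =ᵐ[P] U j := by rw [toL2_eq (hU j)]; exact (hU j).coeFn_toLp
  filter_upwards [h1, h2, coeFn_sum_smul_toL2 hU b,
    Lp.coeFn_sub (toL2 P Z) (∑ j, b j • toL2 P (U j))] with ω h1 h2 h3 h4
  rw [h4, Pi.sub_apply, h1, h2, h3]
  simp [mul_comm]

theorem projL2_ae (hU : ∀ j, MemLp (U j) 2 P) :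
    projL2 P U Z =ᵐ[P] fun ω => ∑ j, projCoeff P U Z j * U j ω := by
  rw [← (exists_coeff P U Z).choose_spec]
  exact coeFn_sum_smul_toL2 hU _

theorem integral_sub_projCoeff_mul (hU : ∀ j, MemLp (U j) 2 P) (hZ : MemLp Z 2 P) (j : Fin m) :
    ∫ ω, (Z ω - ∑ i, projCoeff P U Z i * U i ω) * U j ω ∂P = 0 := by
  rw [← inner_sub_sum_smul_toL2 hU hZ]
  have h : ∑ j, projCoeff P U Z j • toL2 P (U j) = projL2 P U Z :=
    (exists_coeff P U Z).choose_spec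
  rw [h]
  exact Submodule.starProjection_inner_eq_zero _ _ (Submodule.subset_span ⟨j, rfl⟩)

/-- Orthogonality of the residual to the generators characterizes the projection even when the
generators are dependent, so it can be identified from explicit candidate coefficients. -/
theorem projL2_ae_of_integral_eq_zero (hU : ∀ j, MemLp (U j) 2 P) (hZ : MemLp Z 2 P)
    {b : Fin m → ℝ} (hb : ∀ j, ∫ ω, (Z ω - ∑ i, b i * U i ω) * U j ω ∂P = 0) :
    projL2 P U Z =ᵐ[P] fun ω => ∑ j, b j * U j ω := by
  have h : projL2 P U Z = ∑ j, b j • toL2 P (U j) := by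
    apply Submodule.eq_starProjection_of_mem_of_inner_eq_zero
    · exact Submodule.sum_mem _ fun j _ => Submodule.smul_mem _ _ (Submodule.subset_span ⟨j, rfl⟩)
    · intro w hw
      induction hw using Submodule.span_induction with
      | mem w hw =>
        obtain ⟨j, rfl⟩ := hw
        rw [inner_sub_sum_smul_toL2 hU hZ, hb]
      | zero => simp
      | add u v _ _ hu hv => rw [inner_add_right, hu, hv, add_zero]
      | smul c u _ hu => rw [inner_smul_right, hu, mul_zero]
  rw [h]
  exact coeFn_sum_smul_toL2 hU b

end Projection

variable {p : ℕ} {Y : Ω → ℝ} {X : Fin p → Ω → ℝ}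

theorem M0_transpose : (M0 P X)ᵀ = M0 P X := by
  ext j k
  simp [M0, covariance_comm]

variable [IsProbabilityMeasure P]

theorem memLp_withConst {q : ENNReal} (hX : ∀ j, MemLp (X j) q P) (j : Fin (p + 1)) :
    MemLp (withConst X j) q P := by
  refine Fin.cases ?_ (fun j => ?_) j
  · exact memLp_const 1
  · exact hX j

/-- The centred form of the residual of `Y`. -/
noncomputable def epsC (P : Measure Ω) (Y : Ω → ℝ) (X : Fin p → Ω → ℝ) (ω : Ω) : ℝ :=
  (Y ω - P[Y]) - ∑ j, alpha P Y X j * (X j ω - P[X j])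

/-- The centred form of the residual of `X k`. -/
noncomputable def eResC (P : Measure Ω) (Y : Ω → ℝ) (X : Fin p → Ω → ℝ) (k : Fin p) (ω : Ω) : ℝ :=
  (X k ω - P[X k]) - theta P Y X k * (Y ω - P[Y])

theorem projCoeff_zero (hX : ∀ j, MemLp (X j) 2 P) (hY : MemLp Y 2 P) :
    projCoeff P (withConst X) Y 0 = P[Y] - ∑ j, alpha P Y X j * P[X j] := by
  have h := integral_sub_projCoeff_mul (memLp_withConst hX) hY 0
  have h1 : ∀ ω, withConst X 0 ω = 1 := fun ω => by simp [withConst]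
  simp only [h1, mul_one, sum_withConst] at h
  have hi : ∀ j ∈ Finset.univ, Integrable (fun ω => projCoeff P (withConst X) Y j.succ * X j ω) P :=
    fun j _ => ((hX j).integrable one_le_two).const_mul _
  have hi' : Integrable (fun ω => projCoeff P (withConst X) Y 0 +
      ∑ j, projCoeff P (withConst X) Y (Fin.succ j) * X j ω) P :=
    (integrable_const _).add (integrable_finsetSum _ hi)
  rw [integral_sub (hY.integrable one_le_two) hi',
    integral_add (integrable_const _) (integrable_finsetSum _ hi), integral_finsetSum _ hi] at h
  simp only [integral_const_mul, integral_const, probReal_univ, one_smul] at h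
  simp only [alpha]
  linarith

theorem sub_sum_withConst (hX : ∀ j, MemLp (X j) 2 P) (hY : MemLp Y 2 P) (ω : Ω) :
    Y ω - ∑ j, projCoeff P (withConst X) Y j * withConst X j ω = epsC P Y X ω := by
  rw [sum_withConst, projCoeff_zero hX hY]
  simp only [epsC, alpha, mul_sub, Finset.sum_sub_distrib]
  ring

theorem eps_ae (hX : ∀ j, MemLp (X j) 2 P) (hY : MemLp Y 2 P) : eps P Y X =ᵐ[P] epsC P Y X := by
  filter_upwards [projL2_ae (Z := Y) (memLp_withConst hX)] with ω hω
  rw [eps, residual, hω, sub_sum_withConst hX hY]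

theorem memLp_epsC {q : ENNReal} (hX : ∀ j, MemLp (X j) q P) (hY : MemLp Y q P) :
    MemLp (epsC P Y X) q P :=
  (hY.sub (memLp_const _)).sub
    (memLp_finsetSum _ fun j _ => ((hX j).sub (memLp_const _)).const_mul _)

theorem memLp_eResC {q : ENNReal} (hX : ∀ j, MemLp (X j) q P) (hY : MemLp Y q P) (k : Fin p) :
    MemLp (eResC P Y X k) q P :=
  ((hX k).sub (memLp_const _)).sub ((hY.sub (memLp_const _)).const_mul _)

theorem integral_epsC (hX : ∀ j, MemLp (X j) 2 P) (hY : MemLp Y 2 P) :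
    ∫ ω, epsC P Y X ω ∂P = 0 := by
  have h := integral_sub_projCoeff_mul (memLp_withConst hX) hY 0
  simp only [sub_sum_withConst hX hY] at h
  simpa [withConst] using h

theorem integral_mul_epsC (hX : ∀ j, MemLp (X j) 2 P) (hY : MemLp Y 2 P) (k : Fin p) :
    ∫ ω, (X k ω - P[X k]) * epsC P Y X ω ∂P = 0 := by
  have h := integral_sub_projCoeff_mul (memLp_withConst hX) hY k.succ
  simp only [sub_sum_withConst hX hY] at h
  simp only [withConst, Fin.cons_succ] at h
  have hi : Integrable (fun ω => epsC P Y X ω * X k ω) P := (memLp_epsC hX hY).integrable_mul (hX k)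
  have hi' := (memLp_epsC hX hY).integrable one_le_two
  simp only [sub_mul]
  simp only [mul_comm (X k _)]
  rw [integral_sub hi (hi'.const_mul _), h, integral_const_mul, integral_epsC hX hY]
  simp

/-- The population normal equations: expand the orthogonality of each centred regressor to the
residual. -/
theorem M0_mulVec_alpha (hX : ∀ j, MemLp (X j) 2 P) (hY : MemLp Y 2 P) (k : Fin p) :
    (M0 P X *ᵥ alpha P Y X) k = cov[Y, X k; P] := by
  have hXc : ∀ j, MemLp (fun ω => X j ω - P[X j]) 2 P := fun j => (hX j).sub (memLp_const _)
  have hYc : MemLp (fun ω => Y ω - P[Y]) 2 P := hY.sub (memLp_const _)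
  have h := integral_mul_epsC hX hY k
  simp only [epsC, mul_sub, Finset.mul_sum] at h
  have hi : ∀ j ∈ Finset.univ, Integrable (fun ω => alpha P Y X j *
      ((X k ω - P[X k]) * (X j ω - P[X j]))) P :=
    fun j _ => ((hXc k).integrable_mul (hXc j)).const_mul _
  have h' : ∫ ω, ((X k ω - P[X k]) * (Y ω - P[Y]) - ∑ j, alpha P Y X j *
      ((X k ω - P[X k]) * (X j ω - P[X j]))) ∂P = 0 := by
    rw [← h]
    refine integral_congr_ae (ae_of_all _ fun ω => ?_)
    simp only [← mul_sub]
    congr 1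
    exact Finset.sum_congr rfl fun j _ => by ring
  have hi0 : Integrable (fun ω => (X k ω - P[X k]) * (Y ω - P[Y])) P := (hXc k).integrable_mul hYc
  rw [integral_sub hi0 (integrable_finsetSum _ hi), integral_finsetSum _ hi] at h'
  simp only [integral_const_mul] at h'
  rw [covariance_comm]
  simp only [covariance, Matrix.mulVec, dotProduct, M0, Matrix.of_apply]
  simp only [mul_comm _ (alpha P Y X _)]
  linarith

theorem integral_sub_mul_eResC (hX : ∀ j, MemLp (X j) 2 P) (hY : MemLp Y 2 P)
    (hv : Var[Y; P] ≠ 0) (k : Fin p) :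
    ∫ ω, (Y ω - P[Y]) * eResC P Y X k ω ∂P = 0 := by
  have hXc : MemLp (fun ω => X k ω - P[X k]) 2 P := (hX k).sub (memLp_const _)
  have hYc : MemLp (fun ω => Y ω - P[Y]) 2 P := hY.sub (memLp_const _)
  have h1 : ∀ ω, (Y ω - P[Y]) * eResC P Y X k ω = (Y ω - P[Y]) * (X k ω - P[X k]) -
      theta P Y X k * ((Y ω - P[Y]) * (Y ω - P[Y])) := fun ω => by rw [eResC]; ring
  have hi1 : Integrable (fun ω => (Y ω - P[Y]) * (X k ω - P[X k])) P := hYc.integrable_mul hXc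
  have hi2 : Integrable (fun ω => (Y ω - P[Y]) * (Y ω - P[Y])) P := hYc.integrable_mul hYc
  simp only [h1]
  rw [integral_sub hi1 (hi2.const_mul _), integral_const_mul]
  change cov[Y, X k; P] - theta P Y X k * cov[Y, Y; P] = 0
  rw [covariance_self hY.aemeasurable, theta, div_mul_cancel₀ _ hv, sub_self]

theorem integral_sub_integral {f : Ω → ℝ} (hf : Integrable f P) : ∫ ω, (f ω - P[f]) ∂P = 0 := by
  rw [integral_sub hf (integrable_const _)]
  simp

theorem integral_eResC (hX : ∀ j, MemLp (X j) 2 P) (hY : MemLp Y 2 P) (k : Fin p) :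
    ∫ ω, eResC P Y X k ω ∂P = 0 := by
  have h1 : Integrable (fun ω => X k ω - P[X k]) P :=
    ((hX k).sub (memLp_const _)).integrable one_le_two
  have h2 : Integrable (fun ω => Y ω - P[Y]) P := (hY.sub (memLp_const _)).integrable one_le_two
  simp only [eResC]
  rw [integral_sub h1 (h2.const_mul _), integral_const_mul,
    integral_sub_integral ((hX k).integrable one_le_two),
    integral_sub_integral (hY.integrable one_le_two)]
  simp

theorem eRes_ae (hX : ∀ j, MemLp (X j) 2 P) (hY : MemLp Y 2 P) (hv : Var[Y; P] ≠ 0) (k : Fin p) :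
    eRes P Y X k =ᵐ[P] eResC P Y X k := by
  -- The simple regression line of `X k` on `Y`: slope `θ_k`, with the intercept that makes the
  -- residual centred.
  set b : Fin 2 → ℝ := Fin.cons (P[X k] - theta P Y X k * P[Y]) fun _ => theta P Y X k with hb
  have hs : ∀ ω, X k ω - ∑ i, b i * withConst (fun _ : Fin 1 => Y) i ω = eResC P Y X k ω := by
    intro ω
    rw [sum_withConst]
    simp only [hb, eResC, Fin.cons_zero, Fin.cons_succ, Finset.univ_unique, Finset.sum_singleton]
    ring
  have h := projL2_ae_of_integral_eq_zero (Z := X k) (b := b)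
    (memLp_withConst fun _ : Fin 1 => hY) (hX k) (fun j => by
      simp only [hs]
      refine Fin.cases ?_ (fun j => ?_) j
      · simpa [withConst] using integral_eResC hX hY k
      · have h1 := integral_sub_mul_eResC hX hY hv k
        have h2 := integral_eResC hX hY k
        have hi1 : Integrable (fun ω => Y ω * eResC P Y X k ω) P :=
          hY.integrable_mul (memLp_eResC hX hY k)
        have hi2 := (memLp_eResC hX hY k).integrable one_le_two
        simp only [sub_mul] at h1
        rw [integral_sub hi1 (hi2.const_mul _), integral_const_mul, h2, mul_zero, sub_zero] at h1
        simp only [withConst, Fin.cons_succ]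
        simpa only [mul_comm] using h1)
  filter_upwards [h] with ω hω
  rw [eRes, residual, hω, hs]

theorem Rsq_eq (hX : ∀ j, MemLp (X j) 2 P) (hY : MemLp Y 2 P) :
    Rsq P Y X = ∑ k, alpha P Y X k * theta P Y X k := by
  have h : Var[projL2 P (withConst X) Y; P] = ∑ k, alpha P Y X k * cov[Y, X k; P] := by
    rw [variance_congr (projL2_ae (memLp_withConst hX))]
    simp only [sum_withConst]
    have hm : MemLp (fun ω => ∑ j, projCoeff P (withConst X) Y j.succ * X j ω) 2 P :=
      memLp_finsetSum _ fun j _ => (hX j).const_mul _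
    rw [variance_const_add hm.aestronglyMeasurable, ← covariance_self hm.aemeasurable,
      covariance_fun_sum_fun_sum (fun j => (hX j).const_mul _) (fun j => (hX j).const_mul _)]
    refine Finset.sum_congr rfl fun k _ => ?_
    rw [← M0_mulVec_alpha hX hY, Matrix.mulVec, dotProduct, Finset.mul_sum]
    refine Finset.sum_congr rfl fun j _ => ?_
    rw [covariance_const_mul_left, covariance_const_mul_right]
    simp only [M0, Matrix.of_apply, alpha]
    ring
  rw [Rsq, h, Finset.sum_div]
  exact Finset.sum_congr rfl fun k _ => by rw [theta, mul_div_assoc]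

/-- A kernel vector gives a combination of the regressors with variance zero, hence almost surely
constant. Subtracting that constant gives a relation with `1`, which linear independence excludes.
-/
theorem isUnit_det_M0 (hX : ∀ j, MemLp (X j) 2 P) (hlin : LinIndepWithConst P X) :
    IsUnit (M0 P X).det := by
  rw [← Matrix.isUnit_iff_isUnit_det, ← Matrix.mulVec_injective_iff_isUnit]
  refine (injective_iff_map_eq_zero (Matrix.mulVecLin (M0 P X))).2 fun a ha => ?_
  rw [Matrix.mulVecLin_apply] at ha
  have hm : MemLp (fun ω => ∑ j, a j * X j ω) 2 P := memLp_finsetSum _ fun j _ => (hX j).const_mul _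
  have hvar : Var[fun ω => ∑ j, a j * X j ω; P] = 0 := by
    rw [← covariance_self hm.aemeasurable,
      covariance_fun_sum_fun_sum (fun j => (hX j).const_mul _) (fun j => (hX j).const_mul _)]
    refine Finset.sum_eq_zero fun k _ => ?_
    have hk := congrFun ha k
    simp only [Matrix.mulVec, dotProduct, M0, Matrix.of_apply, Pi.zero_apply] at hk
    calc ∑ j, cov[fun ω => a k * X k ω, fun ω => a j * X j ω; P]
        = a k * ∑ j, cov[X k, X j; P] * a j := by
          rw [Finset.mul_sum]
          refine Finset.sum_congr rfl fun j _ => ?_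
          rw [covariance_const_mul_left, covariance_const_mul_right]
          ring
      _ = 0 := by rw [hk, mul_zero]
  have hae := ae_eq_integral_of_variance_eq_zero hm hvar
  have h0 := hlin (Fin.cons (-∫ ω, ∑ j, a j * X j ω ∂P) a) (by
    filter_upwards [hae] with ω hω
    rw [sum_withConst]
    simp only [Fin.cons_zero, Fin.cons_succ]
    rw [hω]
    ring)
  ext j
  simpa using congrFun h0 j.succ

/-- The influence function of the estimator of `R²`. -/
noncomputable def influence (P : Measure Ω) (Y : Ω → ℝ) (X : Fin p → Ω → ℝ) (ω : Ω) : ℝ :=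
  ∑ k, ((M0 P X)⁻¹ *ᵥ theta P Y X) k * ((X k ω - P[X k]) * epsC P Y X ω) +
    ∑ k, alpha P Y X k / Var[Y; P] * ((Y ω - P[Y]) * eResC P Y X k ω)

theorem integral_influence (hX : ∀ j, MemLp (X j) 2 P) (hY : MemLp Y 2 P) (hv : Var[Y; P] ≠ 0) :
    ∫ ω, influence P Y X ω ∂P = 0 := by
  have hi1 : ∀ k ∈ Finset.univ, Integrable (fun ω => ((M0 P X)⁻¹ *ᵥ theta P Y X) k *
      ((X k ω - P[X k]) * epsC P Y X ω)) P := fun k _ =>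
    (((hX k).sub (memLp_const _)).integrable_mul (memLp_epsC hX hY)).const_mul _
  have hi2 : ∀ k ∈ Finset.univ, Integrable (fun ω => alpha P Y X k / Var[Y; P] *
      ((Y ω - P[Y]) * eResC P Y X k ω)) P := fun k _ =>
    ((hY.sub (memLp_const _)).integrable_mul (memLp_eResC hX hY k)).const_mul _
  simp only [influence]
  rw [integral_add (integrable_finsetSum _ hi1) (integrable_finsetSum _ hi2),
    integral_finsetSum _ hi1, integral_finsetSum _ hi2]
  simp only [integral_const_mul, integral_mul_epsC hX hY, integral_sub_mul_eResC hX hY hv]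
  simp

/-- `A` is the `L²` Gram matrix of the products `F s` of a centred variable and a residual, and the
influence function is their combination with coefficients `z = B v`. Its second moment is `zᵗ A z`,
which is `vᵗ B A B v` as `B` is symmetric. Fourth moments put the `F s` in `L²`. -/
theorem asympVar_eq (hX : ∀ j, MemLp (X j) 4 P) (hY : MemLp Y 4 P) (hv : Var[Y; P] ≠ 0) :
    asympVar P Y X = ∫ ω, influence P Y X ω ^ 2 ∂P := by
  have hX2 : ∀ j, MemLp (X j) 2 P := fun j => (hX j).mono_exponent (by norm_num)
  have hY2 : MemLp Y 2 P := hY.mono_exponent (by norm_num)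
  set F : Fin p ⊕ Fin p → Ω → ℝ := Sum.elim (fun j ω => (X j ω - P[X j]) * epsC P Y X ω)
    (fun k ω => (Y ω - P[Y]) * eResC P Y X k ω) with hF
  have hFm : ∀ s, MemLp (F s) 2 P := by
    rintro (j | k)
    · exact memLp_two_mul ((hX j).sub (memLp_const _)) (memLp_epsC hX hY)
    · exact memLp_two_mul (hY.sub (memLp_const _)) (memLp_eResC hX hY k)
  have hA : matA P Y X = Matrix.of fun s t => ∫ ω, F s ω * F t ω ∂P := by
    ext (j | j) (k | k)
    · refine integral_congr_ae ?_
      filter_upwards [eps_ae hX2 hY2] with ω h1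
      simp only [hF, Sum.elim_inl, h1]
      ring
    · refine integral_congr_ae ?_
      filter_upwards [eps_ae hX2 hY2, eRes_ae hX2 hY2 hv k] with ω h1 h2
      simp only [hF, Sum.elim_inl, Sum.elim_inr, h1, h2]
      ring
    · refine integral_congr_ae ?_
      filter_upwards [eps_ae hX2 hY2, eRes_ae hX2 hY2 hv j] with ω h1 h2
      simp only [hF, Sum.elim_inl, Sum.elim_inr, h1, h2]
      ring
    · refine integral_congr_ae ?_
      filter_upwards [eRes_ae hX2 hY2 hv j, eRes_ae hX2 hY2 hv k] with ω h1 h2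
      simp only [hF, Sum.elim_inr, h1, h2]
      ring
  set v : Fin p ⊕ Fin p → ℝ := Sum.elim (theta P Y X) (alpha P Y X) with hvdef
  set z : Fin p ⊕ Fin p → ℝ := matB P Y X *ᵥ v with hz
  have hzeq : z = Sum.elim ((M0 P X)⁻¹ *ᵥ theta P Y X) fun k => alpha P Y X k / Var[Y; P] := by
    rw [hz, hvdef, matB, Matrix.fromBlocks_mulVec]
    ext (k | k)
    · simp
    · simp [Matrix.smul_mulVec, div_eq_inv_mul]
  have hBt : (matB P Y X)ᵀ = matB P Y X := by
    simp [matB, Matrix.fromBlocks_transpose, Matrix.transpose_nonsing_inv, M0_transpose]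
  have hinf : ∀ ω, influence P Y X ω = ∑ s, z s * F s ω := fun ω => by
    rw [hzeq, Fintype.sum_sum_type]
    rfl
  have h1 : asympVar P Y X = z ⬝ᵥ (matA P Y X *ᵥ z) := by
    change v ⬝ᵥ ((matB P Y X * matA P Y X * matB P Y X) *ᵥ v) = _
    rw [← Matrix.mulVec_mulVec, ← Matrix.mulVec_mulVec, Matrix.dotProduct_mulVec,
      ← Matrix.mulVec_transpose, hBt]
  rw [h1, hA]
  simp only [hinf]
  have hi : ∀ s t, Integrable (fun ω => F s ω * F t ω) P := fun s t =>
    (hFm s).integrable_mul (hFm t)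
  have hsq : ∀ ω, (∑ s, z s * F s ω) ^ 2 = ∑ s, ∑ t, z s * z t * (F s ω * F t ω) := fun ω => by
    rw [sq, Finset.sum_mul_sum]
    exact Finset.sum_congr rfl fun s _ => Finset.sum_congr rfl fun t _ => by ring
  simp only [hsq]
  rw [integral_finsetSum _ fun s _ => integrable_finsetSum _ fun t _ => (hi s t).const_mul _]
  refine Finset.sum_congr rfl fun s _ => ?_
  rw [integral_finsetSum _ fun t _ => (hi s t).const_mul _, Matrix.mulVec, dotProduct,
    Finset.mul_sum]
  refine Finset.sum_congr rfl fun t _ => ?_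
  rw [integral_const_mul, Matrix.of_apply]
  ring

end PopulationFacts

/-! ### Consistency of the plug-in estimators. -/

section Consistency

/-- The vector `(1, y, x)`, indexed by `none`, `some none` and `some (some j)`. -/
def obs {p : ℕ} (y : ℝ) (x : Fin p → ℝ) : Option (Option (Fin p)) → ℝ
  | none => 1
  | some none => y
  | some (some j) => x j

variable {Ω κ : Type*} {p : ℕ} {Y : Ω → ℝ} {X : Fin p → Ω → ℝ} {l : Filter κ}
  {N : κ → ℕ} {y : ∀ q, Fin (N q) → ℝ} {x : ∀ q, Fin (N q) → Fin p → ℝ}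

/-- The statistic `f` is, eventually along `l`, an affine function of the observations, whose
coefficients converge to those of the affine function `g` of `(Y, X)`. -/
def AffineTendsto (l : Filter κ) (y : ∀ q, Fin (N q) → ℝ) (x : ∀ q, Fin (N q) → Fin p → ℝ)
    (Y : Ω → ℝ) (X : Fin p → Ω → ℝ) (f : ∀ q, Fin (N q) → ℝ) (g : Ω → ℝ) : Prop :=
  ∃ (w : κ → Option (Option (Fin p)) → ℝ) (w' : Option (Option (Fin p)) → ℝ),
    Tendsto w l (𝓝 w') ∧ (∀ᶠ q in l, ∀ i, f q i = ∑ a, w q a * obs (y q i) (x q i) a) ∧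
      ∀ ω, g ω = ∑ a, w' a * obs (Y ω) (fun j => X j ω) a

namespace AffineTendsto

variable {f f' : ∀ q, Fin (N q) → ℝ} {g g' : Ω → ℝ}

theorem coord (a : Option (Option (Fin p))) :
    AffineTendsto l y x Y X (fun q i => obs (y q i) (x q i) a)
      (fun ω => obs (Y ω) (fun j => X j ω) a) :=
  ⟨fun _ => Pi.single a 1, Pi.single a 1, tendsto_const_nhds,
    Eventually.of_forall fun q i => by simp [Pi.single_apply],
    fun ω => by simp [Pi.single_apply]⟩

theorem one : AffineTendsto l y x Y X (fun _ _ => 1) (fun _ => 1) := coord none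

theorem congr (h : AffineTendsto l y x Y X f g) (hf : ∀ᶠ q in l, ∀ i, f' q i = f q i) :
    AffineTendsto l y x Y X f' g := by
  obtain ⟨w, w', h1, h2, h3⟩ := h
  exact ⟨w, w', h1, by filter_upwards [h2, hf] with q h2 hf i; rw [hf, h2], h3⟩

theorem sub (h : AffineTendsto l y x Y X f g) (h' : AffineTendsto l y x Y X f' g') :
    AffineTendsto l y x Y X (fun q i => f q i - f' q i) (fun ω => g ω - g' ω) := by
  obtain ⟨w, v, h1, h2, h3⟩ := h
  obtain ⟨w', v', h1', h2', h3'⟩ := h'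
  refine ⟨fun q => w q - w' q, v - v', h1.sub h1', ?_, fun ω => ?_⟩
  · filter_upwards [h2, h2'] with q h2 h2' i
    simp [h2, h2', sub_mul, Finset.sum_sub_distrib]
  · simp [h3, h3', sub_mul, Finset.sum_sub_distrib]

theorem const_mul (h : AffineTendsto l y x Y X f g) {c : κ → ℝ} {c' : ℝ}
    (hc : Tendsto c l (𝓝 c')) :
    AffineTendsto l y x Y X (fun q i => c q * f q i) (fun ω => c' * g ω) := by
  obtain ⟨w, v, h1, h2, h3⟩ := h
  refine ⟨fun q => c q • w q, c' • v, hc.smul h1, ?_, fun ω => ?_⟩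
  · filter_upwards [h2] with q h2 i
    simp only [h2, Pi.smul_apply, smul_eq_mul, mul_assoc, Finset.mul_sum]
  · simp only [h3, Pi.smul_apply, smul_eq_mul, mul_assoc, Finset.mul_sum]

theorem sum {F : Fin p → ∀ q, Fin (N q) → ℝ} {G : Fin p → Ω → ℝ}
    (h : ∀ j, AffineTendsto l y x Y X (F j) (G j)) :
    AffineTendsto l y x Y X (fun q i => ∑ j, F j q i) (fun ω => ∑ j, G j ω) := by
  choose w v h1 h2 h3 using h
  refine ⟨fun q => ∑ j, w j q, ∑ j, v j, tendsto_finsetSum _ fun j _ => h1 j, ?_, fun ω => ?_⟩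
  · filter_upwards [eventually_all.2 h2] with q h2 i
    simp only [h2, Finset.sum_apply, Finset.sum_mul]
    exact Finset.sum_comm
  · simp only [h3, Finset.sum_apply, Finset.sum_mul]
    exact Finset.sum_comm

end AffineTendsto

variable [MeasurableSpace Ω] {P : Measure Ω}

theorem memLp_obs [IsFiniteMeasure P] {r : ENNReal} (hX : ∀ j, MemLp (X j) r P) (hY : MemLp Y r P)
    (a : Option (Option (Fin p))) : MemLp (fun ω => obs (Y ω) (fun j => X j ω) a) r P := by
  rcases a with _ | _ | j
  · exact memLp_const 1
  · exact hY
  · exact hX j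

/-- The empirical moments of order at most four of the samples converge along `l` to the moments
of `(Y, X)`. -/
def MomentsTendsto (l : Filter κ) (y : ∀ q, Fin (N q) → ℝ) (x : ∀ q, Fin (N q) → Fin p → ℝ)
    (P : Measure Ω) (Y : Ω → ℝ) (X : Fin p → Ω → ℝ) : Prop :=
  ∀ a b c d, Tendsto (fun q => mean fun i => obs (y q i) (x q i) a * obs (y q i) (x q i) b *
      obs (y q i) (x q i) c * obs (y q i) (x q i) d) l
    (𝓝 (∫ ω, obs (Y ω) (fun j => X j ω) a * obs (Y ω) (fun j => X j ω) b *
      obs (Y ω) (fun j => X j ω) c * obs (Y ω) (fun j => X j ω) d ∂P))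

namespace AffineTendsto

variable {f f₁ f₂ f₃ f₄ : ∀ q, Fin (N q) → ℝ} {g g₁ g₂ g₃ g₄ : Ω → ℝ}

variable [IsFiniteMeasure P]

/-- The coefficients do not depend on the index `i`, so they come out of the empirical mean once the
product is expanded into monomials of degree four in `obs`. The constant coordinate covers lower
degrees. -/
theorem tendsto_mean_mul₄ (hX : ∀ j, MemLp (X j) 4 P) (hY : MemLp Y 4 P)
    (hm : MomentsTendsto l y x P Y X)
    (h₁ : AffineTendsto l y x Y X f₁ g₁) (h₂ : AffineTendsto l y x Y X f₂ g₂)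
    (h₃ : AffineTendsto l y x Y X f₃ g₃) (h₄ : AffineTendsto l y x Y X f₄ g₄) :
    Tendsto (fun q => mean fun i => f₁ q i * f₂ q i * f₃ q i * f₄ q i) l
      (𝓝 (∫ ω, g₁ ω * g₂ ω * g₃ ω * g₄ ω ∂P)) := by
  obtain ⟨w₁, v₁, ht₁, he₁, hg₁⟩ := h₁
  obtain ⟨w₂, v₂, ht₂, he₂, hg₂⟩ := h₂
  obtain ⟨w₃, v₃, ht₃, he₃, hg₃⟩ := h₃
  obtain ⟨w₄, v₄, ht₄, he₄, hg₄⟩ := h₄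
  have hexp : ∀ u₁ u₂ u₃ u₄ z : Option (Option (Fin p)) → ℝ,
      (∑ a, u₁ a * z a) * (∑ b, u₂ b * z b) * (∑ c, u₃ c * z c) * (∑ d, u₄ d * z d) =
        ∑ a, ∑ b, ∑ c, ∑ d, u₁ a * u₂ b * u₃ c * u₄ d * (z a * z b * z c * z d) := by
    intro u₁ u₂ u₃ u₄ z
    rw [Finset.sum_mul_sum, Finset.sum_mul, Finset.sum_mul]
    refine Finset.sum_congr rfl fun a _ => ?_
    rw [Finset.sum_mul_sum, Finset.sum_mul]
    refine Finset.sum_congr rfl fun b _ => ?_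
    rw [Finset.sum_mul_sum]
    exact Finset.sum_congr rfl fun c _ => Finset.sum_congr rfl fun d _ => by ring
  have hlim : ∫ ω, g₁ ω * g₂ ω * g₃ ω * g₄ ω ∂P = ∑ a, ∑ b, ∑ c, ∑ d, v₁ a * v₂ b * v₃ c * v₄ d *
      ∫ ω, obs (Y ω) (fun j => X j ω) a * obs (Y ω) (fun j => X j ω) b *
        obs (Y ω) (fun j => X j ω) c * obs (Y ω) (fun j => X j ω) d ∂P := by
    have hi : ∀ a b c d, Integrable (fun ω => v₁ a * v₂ b * v₃ c * v₄ d *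
        (obs (Y ω) (fun j => X j ω) a * obs (Y ω) (fun j => X j ω) b *
        obs (Y ω) (fun j => X j ω) c * obs (Y ω) (fun j => X j ω) d)) P := fun a b c d =>
      (integrable_mul₄ (memLp_obs hX hY a) (memLp_obs hX hY b) (memLp_obs hX hY c)
        (memLp_obs hX hY d)).const_mul _
    simp only [hg₁, hg₂, hg₃, hg₄, hexp]
    rw [integral_finsetSum _ fun a _ => integrable_finsetSum _ fun b _ =>
      integrable_finsetSum _ fun c _ => integrable_finsetSum _ fun d _ => hi a b c d]
    refine Finset.sum_congr rfl fun a _ => ?_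
    rw [integral_finsetSum _ fun b _ =>
      integrable_finsetSum _ fun c _ => integrable_finsetSum _ fun d _ => hi a b c d]
    refine Finset.sum_congr rfl fun b _ => ?_
    rw [integral_finsetSum _ fun c _ => integrable_finsetSum _ fun d _ => hi a b c d]
    refine Finset.sum_congr rfl fun c _ => ?_
    rw [integral_finsetSum _ fun d _ => hi a b c d]
    exact Finset.sum_congr rfl fun d _ => integral_const_mul _ _
  rw [hlim]
  have ht : Tendsto (fun q => ∑ a, ∑ b, ∑ c, ∑ d, w₁ q a * w₂ q b * w₃ q c * w₄ q d *
      mean fun i => obs (y q i) (x q i) a * obs (y q i) (x q i) b *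
        obs (y q i) (x q i) c * obs (y q i) (x q i) d) l
      (𝓝 (∑ a, ∑ b, ∑ c, ∑ d, v₁ a * v₂ b * v₃ c * v₄ d *
        ∫ ω, obs (Y ω) (fun j => X j ω) a * obs (Y ω) (fun j => X j ω) b *
          obs (Y ω) (fun j => X j ω) c * obs (Y ω) (fun j => X j ω) d ∂P)) :=
    tendsto_finsetSum _ fun a _ => tendsto_finsetSum _ fun b _ => tendsto_finsetSum _ fun c _ =>
      tendsto_finsetSum _ fun d _ => ((((tendsto_pi_nhds.1 ht₁ a).mul (tendsto_pi_nhds.1 ht₂ b)).mul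
        (tendsto_pi_nhds.1 ht₃ c)).mul (tendsto_pi_nhds.1 ht₄ d)).mul (hm a b c d)
  refine ht.congr' ?_
  filter_upwards [he₁, he₂, he₃, he₄] with q h1 h2 h3 h4
  simp only [h1, h2, h3, h4, hexp, mean_sum, mean_const_mul]

theorem tendsto_mean_mul (hX : ∀ j, MemLp (X j) 4 P) (hY : MemLp Y 4 P)
    (hm : MomentsTendsto l y x P Y X)
    (h₁ : AffineTendsto l y x Y X f₁ g₁) (h₂ : AffineTendsto l y x Y X f₂ g₂) :
    Tendsto (fun q => mean fun i => f₁ q i * f₂ q i) l (𝓝 (∫ ω, g₁ ω * g₂ ω ∂P)) := by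
  simpa using tendsto_mean_mul₄ hX hY hm h₁ h₂ one one

theorem tendsto_mean (hX : ∀ j, MemLp (X j) 4 P) (hY : MemLp Y 4 P)
    (hm : MomentsTendsto l y x P Y X) (h : AffineTendsto l y x Y X f g) :
    Tendsto (fun q => mean (f q)) l (𝓝 (∫ ω, g ω ∂P)) := by
  simpa using tendsto_mean_mul hX hY hm h one

/-- Empirical centring stays within affine statistics: it shifts the constant coefficient by a
convergent quantity. -/
theorem sub_mean (hX : ∀ j, MemLp (X j) 4 P) (hY : MemLp Y 4 P)
    (hm : MomentsTendsto l y x P Y X) (h : AffineTendsto l y x Y X f g) :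
    AffineTendsto l y x Y X (fun q i => f q i - mean (f q)) (fun ω => g ω - P[g]) := by
  simpa using h.sub (one.const_mul (tendsto_mean hX hY hm h))

end AffineTendsto

/-- By the adjugate formula the inverse is a continuous function of the entries wherever the
determinant is nonzero; the approximating matrices need not be invertible. -/
theorem tendsto_matrix_inv {m : ℕ} {M : κ → Matrix (Fin m) (Fin m) ℝ}
    {M' : Matrix (Fin m) (Fin m) ℝ} (h : Tendsto M l (𝓝 M')) (hM' : IsUnit M'.det) :
    Tendsto (fun q => (M q)⁻¹) l (𝓝 M'⁻¹) := by
  simp only [Matrix.inv_def, Ring.inverse_eq_inv']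
  have hd : Tendsto (fun q => (M q).det) l (𝓝 M'.det) :=
    ((continuous_id.matrix_det).tendsto M').comp h
  have ha : Tendsto (fun q => (M q).adjugate) l (𝓝 M'.adjugate) :=
    ((continuous_id.matrix_adjugate).tendsto M').comp h
  exact (hd.inv₀ hM'.ne_zero).smul ha

theorem tendsto_mulVec {m n : Type*} [Fintype n] {M : κ → Matrix m n ℝ} {M' : Matrix m n ℝ}
    {v : κ → n → ℝ} {v' : n → ℝ} (hM : Tendsto M l (𝓝 M')) (hv : Tendsto v l (𝓝 v')) :
    Tendsto (fun q => M q *ᵥ v q) l (𝓝 (M' *ᵥ v')) :=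
  ((continuous_fst.matrix_mulVec continuous_snd).tendsto (M', v')).comp (hM.prodMk_nhds hv)

variable [IsProbabilityMeasure P]

theorem affineTendsto_response_sub_mean (hX : ∀ j, MemLp (X j) 4 P) (hY : MemLp Y 4 P)
    (hm : MomentsTendsto l y x P Y X) :
    AffineTendsto l y x Y X (fun q i => y q i - mean (y q)) (fun ω => Y ω - P[Y]) :=
  (AffineTendsto.coord (some none)).sub_mean hX hY hm

theorem affineTendsto_centred (hX : ∀ j, MemLp (X j) 4 P) (hY : MemLp Y 4 P)
    (hm : MomentsTendsto l y x P Y X) (j : Fin p) :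
    AffineTendsto l y x Y X (fun q i => centred (x q) i j) (fun ω => X j ω - P[X j]) :=
  (AffineTendsto.coord (some (some j))).sub_mean hX hY hm

theorem tendsto_covHat (hX : ∀ j, MemLp (X j) 4 P) (hY : MemLp Y 4 P)
    (hm : MomentsTendsto l y x P Y X) : Tendsto (fun q => covHat (x q)) l (𝓝 (M0 P X)) :=
  tendsto_pi_nhds.2 fun j => tendsto_pi_nhds.2 fun k =>
    (affineTendsto_centred hX hY hm j).tendsto_mean_mul hX hY hm (affineTendsto_centred hX hY hm k)

theorem tendsto_varN (hX : ∀ j, MemLp (X j) 4 P) (hY : MemLp Y 4 P)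
    (hm : MomentsTendsto l y x P Y X) : Tendsto (fun q => varN (y q)) l (𝓝 Var[Y; P]) := by
  have h := (affineTendsto_response_sub_mean hX hY hm).tendsto_mean_mul hX hY hm
    (affineTendsto_response_sub_mean hX hY hm)
  rw [← covariance_self hY.aemeasurable]
  refine h.congr fun q => ?_
  simp only [varN, mean, sq]

theorem tendsto_crossCovHat (hX : ∀ j, MemLp (X j) 4 P) (hY : MemLp Y 4 P)
    (hm : MomentsTendsto l y x P Y X) :
    Tendsto (fun q => crossCovHat (y q) (x q)) l (𝓝 fun k => cov[Y, X k; P]) :=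
  tendsto_pi_nhds.2 fun k => (affineTendsto_response_sub_mean hX hY hm).tendsto_mean_mul hX hY hm
    (affineTendsto_centred hX hY hm k)

theorem tendsto_thetaHat (hX : ∀ j, MemLp (X j) 4 P) (hY : MemLp Y 4 P)
    (hm : MomentsTendsto l y x P Y X) (hN : ∀ᶠ q in l, N q ≠ 0) (hv : Var[Y; P] ≠ 0) :
    Tendsto (fun q => thetaHat (y q) (x q)) l (𝓝 (theta P Y X)) := by
  refine tendsto_pi_nhds.2 fun k => ?_
  refine ((tendsto_pi_nhds.1 (tendsto_crossCovHat hX hY hm) k).div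
    (tendsto_varN hX hY hm) hv).congr' ?_
  filter_upwards [hN] with q hq
  rw [thetaHat_eq hq]
  rfl

theorem eventually_isUnit_det_covHat (hX : ∀ j, MemLp (X j) 4 P) (hY : MemLp Y 4 P)
    (hm : MomentsTendsto l y x P Y X) (hlin : LinIndepWithConst P X) :
    ∀ᶠ q in l, IsUnit (covHat (x q)).det := by
  have hX2 : ∀ j, MemLp (X j) 2 P := fun j => (hX j).mono_exponent (by norm_num)
  have h : Tendsto (fun q => (covHat (x q)).det) l (𝓝 (M0 P X).det) :=
    ((continuous_id.matrix_det).tendsto _).comp (tendsto_covHat hX hY hm)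
  filter_upwards [h.eventually_ne (isUnit_det_M0 hX2 hlin).ne_zero] with q hq
  exact isUnit_iff_ne_zero.2 hq

theorem tendsto_alphaHat (hX : ∀ j, MemLp (X j) 4 P) (hY : MemLp Y 4 P)
    (hm : MomentsTendsto l y x P Y X) (hN : ∀ᶠ q in l, N q ≠ 0) (hlin : LinIndepWithConst P X) :
    Tendsto (fun q => alphaHat (y q) (x q)) l (𝓝 (alpha P Y X)) := by
  have hX2 : ∀ j, MemLp (X j) 2 P := fun j => (hX j).mono_exponent (by norm_num)
  have hY2 : MemLp Y 2 P := hY.mono_exponent (by norm_num)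
  have hu := isUnit_det_M0 hX2 hlin
  have hα : alpha P Y X = (M0 P X)⁻¹ *ᵥ fun k => cov[Y, X k; P] := by
    rw [← funext (M0_mulVec_alpha hX2 hY2), Matrix.mulVec_mulVec, Matrix.nonsing_inv_mul _ hu,
      Matrix.one_mulVec]
  rw [hα]
  refine (tendsto_mulVec (tendsto_matrix_inv (tendsto_covHat hX hY hm) hu)
    (tendsto_crossCovHat hX hY hm)).congr' ?_
  filter_upwards [hN, eventually_isUnit_det_covHat hX hY hm hlin] with q h1 h2
  rw [alphaHat_eq h1 h2]

/-- The centred form of the residuals requires an invertible `covHat`, hence an equality that holds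
only eventually along `l`. -/
theorem affineTendsto_epsHat (hX : ∀ j, MemLp (X j) 4 P) (hY : MemLp Y 4 P)
    (hm : MomentsTendsto l y x P Y X) (hN : ∀ᶠ q in l, N q ≠ 0) (hlin : LinIndepWithConst P X) :
    AffineTendsto l y x Y X (fun q => epsHat (y q) (x q)) (epsC P Y X) := by
  refine AffineTendsto.congr ((affineTendsto_response_sub_mean hX hY hm).sub
    (AffineTendsto.sum fun j => (affineTendsto_centred hX hY hm j).const_mul
      (tendsto_pi_nhds.1 (tendsto_alphaHat hX hY hm hN hlin) j))) ?_
  filter_upwards [hN, eventually_isUnit_det_covHat hX hY hm hlin] with q h1 h2 i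
  exact epsHat_eq h1 h2 i

theorem affineTendsto_eHat (hX : ∀ j, MemLp (X j) 4 P) (hY : MemLp Y 4 P)
    (hm : MomentsTendsto l y x P Y X) (hN : ∀ᶠ q in l, N q ≠ 0) (hv : Var[Y; P] ≠ 0) (k : Fin p) :
    AffineTendsto l y x Y X (fun q => eHat (y q) (x q) k) (eResC P Y X k) :=
  (affineTendsto_centred hX hY hm k).sub ((affineTendsto_response_sub_mean hX hY hm).const_mul
    (tendsto_pi_nhds.1 (tendsto_thetaHat hX hY hm hN hv) k))

/-- Every entry is a mean of a product of exactly four affine statistics, and the residuals of the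
population agree almost surely with their centred forms. -/
theorem tendsto_matAHat (hX : ∀ j, MemLp (X j) 4 P) (hY : MemLp Y 4 P)
    (hm : MomentsTendsto l y x P Y X) (hN : ∀ᶠ q in l, N q ≠ 0) (hlin : LinIndepWithConst P X)
    (hv : Var[Y; P] ≠ 0) :
    Tendsto (fun q => matAHat (y q) (x q)) l (𝓝 (matA P Y X)) := by
  have hX2 : ∀ j, MemLp (X j) 2 P := fun j => (hX j).mono_exponent (by norm_num)
  have hY2 : MemLp Y 2 P := hY.mono_exponent (by norm_num)
  have hx := affineTendsto_centred hX hY hm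
  have hy := affineTendsto_response_sub_mean hX hY hm
  have hε := affineTendsto_epsHat hX hY hm hN hlin
  have he := affineTendsto_eHat hX hY hm hN hv
  have h12 : ∀ j k, Tendsto (fun q => (1 / (N q : ℝ)) * ∑ i, centred (x q) i j *
      (y q i - mean (y q)) * epsHat (y q) (x q) i * eHat (y q) (x q) k i) l
      (𝓝 (∫ ω, (X j ω - P[X j]) * (Y ω - P[Y]) * eps P Y X ω * eRes P Y X k ω ∂P)) := by
    intro j k
    have h := (hx j).tendsto_mean_mul₄ hX hY hm hy hε (he k)
    rw [integral_congr_ae (g := fun ω => (X j ω - P[X j]) * (Y ω - P[Y]) * epsC P Y X ω *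
      eResC P Y X k ω)]
    · exact h
    · filter_upwards [eps_ae hX2 hY2, eRes_ae hX2 hY2 hv k] with ω h1 h2
      rw [h1, h2]
  refine tendsto_pi_nhds.2 fun s => tendsto_pi_nhds.2 fun t => ?_
  rcases s with j | j <;> rcases t with k | k
  · have h := (hx j).tendsto_mean_mul₄ hX hY hm (hx k) hε hε
    have h' : matA P Y X (Sum.inl j) (Sum.inl k) =
        ∫ ω, (X j ω - P[X j]) * (X k ω - P[X k]) * epsC P Y X ω * epsC P Y X ω ∂P := by
      refine integral_congr_ae ?_
      filter_upwards [eps_ae hX2 hY2] with ω h1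
      simp only [h1]
      ring
    rw [h']
    refine h.congr fun q => ?_
    simp only [matAHat, Matrix.fromBlocks_apply₁₁, Matrix.of_apply, mean, sq, mul_assoc]
  · exact h12 j k
  · exact h12 k j
  · have h := hy.tendsto_mean_mul₄ hX hY hm hy (he j) (he k)
    have h' : matA P Y X (Sum.inr j) (Sum.inr k) =
        ∫ ω, (Y ω - P[Y]) * (Y ω - P[Y]) * eResC P Y X j ω * eResC P Y X k ω ∂P := by
      refine integral_congr_ae ?_
      filter_upwards [eRes_ae hX2 hY2 hv j, eRes_ae hX2 hY2 hv k] with ω h1 h2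
      simp only [h1, h2]
      ring
    rw [h']
    refine h.congr fun q => ?_
    simp only [matAHat, Matrix.fromBlocks_apply₂₂, Matrix.of_apply, mean, sq, mul_assoc]

theorem tendsto_matBHat (hX : ∀ j, MemLp (X j) 4 P) (hY : MemLp Y 4 P)
    (hm : MomentsTendsto l y x P Y X) (hN : ∀ᶠ q in l, N q ≠ 0) (hlin : LinIndepWithConst P X)
    (hv : Var[Y; P] ≠ 0) :
    Tendsto (fun q => matBHat (y q) (x q)) l (𝓝 (matB P Y X)) := by
  have hX2 : ∀ j, MemLp (X j) 2 P := fun j => (hX j).mono_exponent (by norm_num)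
  have h1 := tendsto_matrix_inv (tendsto_covHat hX hY hm) (isUnit_det_M0 hX2 hlin)
  have h2 := ((tendsto_varN hX hY hm).inv₀ hv).smul_const (1 : Matrix (Fin p) (Fin p) ℝ)
  have hc : Continuous fun M : Matrix (Fin p) (Fin p) ℝ × Matrix (Fin p) (Fin p) ℝ =>
      Matrix.fromBlocks M.1 0 0 M.2 :=
    continuous_fst.matrix_fromBlocks continuous_const continuous_const continuous_snd
  refine ((hc.tendsto _).comp (h1.prodMk_nhds h2)).congr' ?_
  filter_upwards [hN] with q hq
  simp only [Function.comp, matBHat, smul_inv_eq_covHat_inv hq]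

/-- Consistency of the plug-in estimator of the asymptotic variance. -/
theorem tendsto_asympVarHat (hX : ∀ j, MemLp (X j) 4 P) (hY : MemLp Y 4 P)
    (hm : MomentsTendsto l y x P Y X) (hN : ∀ᶠ q in l, N q ≠ 0) (hlin : LinIndepWithConst P X)
    (hv : Var[Y; P] ≠ 0) :
    Tendsto (fun q => asympVarHat (y q) (x q)) l (𝓝 (asympVar P Y X)) := by
  have hA := tendsto_matAHat hX hY hm hN hlin hv
  have hB := tendsto_matBHat hX hY hm hN hlin hv
  have hw : Tendsto (fun q => (Sum.elim (thetaHat (y q) (x q)) (alphaHat (y q) (x q)) :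
      Fin p ⊕ Fin p → ℝ)) l (𝓝 (Sum.elim (theta P Y X) (alpha P Y X))) := by
    refine tendsto_pi_nhds.2 fun s => ?_
    rcases s with k | k
    · exact tendsto_pi_nhds.1 (tendsto_thetaHat hX hY hm hN hv) k
    · exact tendsto_pi_nhds.1 (tendsto_alphaHat hX hY hm hN hlin) k
  have hBAB := (hB.mul hA).mul hB
  have hmv := tendsto_mulVec hBAB hw
  exact tendsto_finsetSum (Finset.univ : Finset (Fin p ⊕ Fin p)) fun s _ =>
    (tendsto_pi_nhds.1 hw s).mul (tendsto_pi_nhds.1 hmv s)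

end Consistency

/-! ### Expansion of the estimator around population values. -/

section Linearization

variable {n p : ℕ} {y : Fin n → ℝ} {x : Fin n → Fin p → ℝ}

/-- The affine function `y - μy - ∑ α_j (x_j - μ_j)` of an observation `(y, x)`. -/
def resp (μy : ℝ) (μ α : Fin p → ℝ) (z : ℝ × (Fin p → ℝ)) : ℝ :=
  (z.1 - μy) - ∑ j, α j * (z.2 j - μ j)

/-- The affine function `x_k - μ_k - θ_k (y - μy)` of an observation `(y, x)`. -/
def regr (μy : ℝ) (μ θ : Fin p → ℝ) (k : Fin p) (z : ℝ × (Fin p → ℝ)) : ℝ :=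
  (z.2 k - μ k) - θ k * (z.1 - μy)

theorem measurable_resp (μy : ℝ) (μ α : Fin p → ℝ) : Measurable (resp μy μ α) := by
  unfold resp; fun_prop

theorem measurable_regr (μy : ℝ) (μ θ : Fin p → ℝ) (k : Fin p) :
    Measurable (regr μy μ θ k) := by
  unfold regr; fun_prop

/-- The residual with empirical centring is `resp` minus its own empirical mean, so
`mean_mul_sub_mean` applies. Its second constant is `0` because `resp` is already centred in the
population. -/
theorem mean_centred_mul_resp (hn : n ≠ 0) (μy : ℝ) (μ α : Fin p → ℝ) (k : Fin p) :
    mean (fun i => centred x i k * ((y i - mean y) - ∑ j, α j * centred x i j)) =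
      mean (fun i => (x i k - μ k) * resp μy μ α (y i, x i)) -
        (mean (fun i => x i k) - μ k) * mean (fun i => resp μy μ α (y i, x i)) := by
  have h := mean_mul_sub_mean (fun i => x i k) (fun i => resp μy μ α (y i, x i)) (μ k) 0
  simp only [sub_zero] at h
  rw [← h]
  congr 1; ext i
  have hm : mean (fun i => resp μy μ α (y i, x i)) =
      (mean y - μy) - ∑ j, α j * (mean (fun i => x i j) - μ j) := by
    simp only [resp]
    rw [mean_sub, mean_sub, mean_const hn, mean_sum]
    congr 1
    refine Finset.sum_congr rfl fun j _ => ?_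
    rw [mean_const_mul, mean_sub, mean_const hn]
  rw [hm]
  simp only [resp, centred, Matrix.of_apply, mul_sub, Finset.sum_sub_distrib]
  ring

theorem mean_sub_mul_regr (hn : n ≠ 0) (μy : ℝ) (μ θ : Fin p → ℝ) (k : Fin p) :
    mean (fun i => (y i - mean y) * (centred x i k - θ k * (y i - mean y))) =
      mean (fun i => (y i - μy) * regr μy μ θ k (y i, x i)) -
        (mean y - μy) * mean (fun i => regr μy μ θ k (y i, x i)) := by
  have h := mean_mul_sub_mean y (fun i => regr μy μ θ k (y i, x i)) μy 0
  simp only [sub_zero] at h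
  rw [← h]
  congr 1; ext i
  have hm : mean (fun i => regr μy μ θ k (y i, x i)) =
      (mean (fun i => x i k) - μ k) - θ k * (mean y - μy) := by
    simp only [regr]
    rw [mean_sub, mean_sub, mean_const hn, mean_const_mul, mean_sub, mean_const hn]
  rw [hm]
  simp only [regr, centred, Matrix.of_apply]
  ring

/-- The influence function as a function of an observation. -/
def influenceFun (μy : ℝ) (μ α θ a b : Fin p → ℝ) (z : ℝ × (Fin p → ℝ)) : ℝ :=
  ∑ k, a k * ((z.2 k - μ k) * resp μy μ α z) + ∑ k, b k * ((z.1 - μy) * regr μy μ θ k z)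

theorem measurable_influenceFun (μy : ℝ) (μ α θ a b : Fin p → ℝ) :
    Measurable (influenceFun μy μ α θ a b) := by
  have h1 := measurable_resp μy μ α
  have h2 := measurable_regr μy μ θ
  unfold influenceFun; fun_prop

/-- With `s = √n` and `a`, `b` the limits of the random weights, each remainder term is a
coefficient tending to `0` times the normalized mean of a centred function. -/
theorem sqrt_mul_RsqHat_sub (hn : n ≠ 0) (hx : IsUnit (covHat x).det) (hy : varN y ≠ 0)
    (μy : ℝ) (μ α θ a b : Fin p → ℝ) (s : ℝ) :
    s * (RsqHat y x - ∑ k, α k * θ k) -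
        s * mean (fun i => influenceFun μy μ α θ a b (y i, x i)) =
      ∑ k, ((((covHat x)⁻¹ *ᵥ thetaHat y x) k - a k) *
            (s * mean (fun i => (x i k - μ k) * resp μy μ α (y i, x i))) -
          ((covHat x)⁻¹ *ᵥ thetaHat y x) k * (mean (fun i => x i k) - μ k) *
            (s * mean (fun i => resp μy μ α (y i, x i)))) +
        ∑ k, ((α k / varN y - b k) *
            (s * mean (fun i => (y i - μy) * regr μy μ θ k (y i, x i))) -
          α k / varN y * (mean y - μy) * (s * mean (fun i => regr μy μ θ k (y i, x i)))) := by
  have hinf : mean (fun i => influenceFun μy μ α θ a b (y i, x i)) =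
      ∑ k, a k * mean (fun i => (x i k - μ k) * resp μy μ α (y i, x i)) +
        ∑ k, b k * mean (fun i => (y i - μy) * regr μy μ θ k (y i, x i)) := by
    simp only [influenceFun]
    rw [mean_add, mean_sum, mean_sum]
    simp only [mean_const_mul]
  rw [RsqHat_sub hn hx hy α θ, hinf]
  simp only [mean_centred_mul_resp hn μy μ, mean_sub_mul_regr hn μy μ]
  rw [← mul_sub, add_sub_add_comm, ← Finset.sum_sub_distrib, ← Finset.sum_sub_distrib, mul_add,
    Finset.mul_sum, Finset.mul_sum]
  congr 1 <;> exact Finset.sum_congr rfl fun k _ => by ring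

end Linearization

/-! ### Asymptotic normality and coverage. -/

section Main

variable {Ω₀ Ω : Type*} [MeasurableSpace Ω₀] [MeasurableSpace Ω]
  {P₀ : Measure Ω₀} [IsProbabilityMeasure P₀] {P : Measure Ω} [IsProbabilityMeasure P]
  {p : ℕ} {Y : Ω₀ → ℝ} {X : Fin p → Ω₀ → ℝ} {Ys : ℕ → Ω → ℝ} {Xs : ℕ → Fin p → Ω → ℝ}

theorem momentsTendsto_inProb
    (h_indep : iIndepFun (fun i ω => (Ys i ω, fun j => Xs i j ω)) P)
    (h_copy : ∀ i, IdentDistrib (fun ω => (Ys i ω, fun j => Xs i j ω))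
      (fun ω => (Y ω, fun j => X j ω)) P P₀)
    (hX : ∀ j, MemLp (X j) 4 P₀) (hY : MemLp Y 4 P₀) :
    MomentsTendsto (inProb P) (fun q (i : Fin q.1) => Ys i q.2) (fun q i j => Xs i j q.2)
      P₀ Y X := by
  intro a b c d
  have hmeas : ∀ a, Measurable fun z : ℝ × (Fin p → ℝ) => obs z.1 z.2 a := by
    rintro (_ | _ | j) <;> simp only [obs] <;> fun_prop
  exact tendsto_mean_inProb h_indep h_copy
    (f := fun z => obs z.1 z.2 a * obs z.1 z.2 b * obs z.1 z.2 c * obs z.1 z.2 d)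
    ((((hmeas a).mul (hmeas b)).mul (hmeas c)).mul (hmeas d))
    (integrable_mul₄ (memLp_obs hX hY a) (memLp_obs hX hY b) (memLp_obs hX hY c)
      (memLp_obs hX hY d))

/-- Up to a term converging to `0` in probability, `√n (R̂² - R²)` is the normalized sum of the
influence function. -/
theorem tendsto_sqrt_mul_RsqHat_sub
    (h_indep : iIndepFun (fun i ω => (Ys i ω, fun j => Xs i j ω)) P)
    (h_copy : ∀ i, IdentDistrib (fun ω => (Ys i ω, fun j => Xs i j ω))
      (fun ω => (Y ω, fun j => X j ω)) P P₀)
    (hlin : LinIndepWithConst P₀ X) (hX : ∀ j, MemLp (X j) 4 P₀) (hY : MemLp Y 4 P₀)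
    (hv : Var[Y; P₀] ≠ 0) :
    Tendsto (fun q : ℕ × Ω => √(q.1 : ℝ) *
        (RsqHat (fun i : Fin q.1 => Ys i q.2) (fun i j => Xs i j q.2) - Rsq P₀ Y X) -
      √(q.1 : ℝ) * mean (fun i : Fin q.1 => influenceFun P₀[Y] (fun j => P₀[X j]) (alpha P₀ Y X)
        (theta P₀ Y X) ((M0 P₀ X)⁻¹ *ᵥ theta P₀ Y X) (fun k => alpha P₀ Y X k / Var[Y; P₀])
        (Ys i q.2, fun j => Xs i j q.2))) (inProb P) (𝓝 0) := by
  have hX2 : ∀ j, MemLp (X j) 2 P₀ := fun j => (hX j).mono_exponent (by norm_num)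
  have hY2 : MemLp Y 2 P₀ := hY.mono_exponent (by norm_num)
  have hm := momentsTendsto_inProb h_indep h_copy hX hY
  have hN : ∀ᶠ q : ℕ × Ω in inProb P, q.1 ≠ 0 :=
    (tendsto_fst_inProb P).eventually (eventually_ne_atTop 0)
  -- Disposes of all four kinds of remainder: weight errors in `t1` and `t3`, centring errors in
  -- `t2` and `t4`.
  have tight : ∀ {f : ℝ × (Fin p → ℝ) → ℝ}, Measurable f →
      MemLp (fun ω => f (Y ω, fun j => X j ω)) 2 P₀ → ∫ ω, f (Y ω, fun j => X j ω) ∂P₀ = 0 →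
      ∀ {c : ℕ × Ω → ℝ}, Tendsto c (inProb P) (𝓝 0) →
      Tendsto (fun q : ℕ × Ω => c q *
        (√(q.1 : ℝ) * mean (fun i : Fin q.1 => f (Ys i q.2, fun j => Xs i j q.2))))
        (inProb P) (𝓝 0) := fun hf h2 h0 _ hc =>
    tendsto_mul_zero_of_tight hc fun K hK n =>
      measure_sqrt_mul_mean_ge h_indep h_copy hf h2 h0 K hK n
  have ha : Tendsto (fun q : ℕ × Ω => (covHat (fun (i : Fin q.1) j => Xs i j q.2))⁻¹ *ᵥ
      thetaHat (fun i : Fin q.1 => Ys i q.2) (fun i j => Xs i j q.2)) (inProb P)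
      (𝓝 ((M0 P₀ X)⁻¹ *ᵥ theta P₀ Y X)) :=
    tendsto_mulVec (tendsto_matrix_inv (tendsto_covHat hX hY hm) (isUnit_det_M0 hX2 hlin))
      (tendsto_thetaHat hX hY hm hN hv)
  have hvar := tendsto_varN hX hY hm
  have hb : ∀ k, Tendsto (fun q : ℕ × Ω => alpha P₀ Y X k / varN (fun i : Fin q.1 => Ys i q.2))
      (inProb P) (𝓝 (alpha P₀ Y X k / Var[Y; P₀])) := fun k => tendsto_const_nhds.div hvar hv
  have hmx : ∀ k, Tendsto (fun q : ℕ × Ω => mean (fun i : Fin q.1 => Xs i k q.2) - P₀[X k])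
      (inProb P) (𝓝 0) := fun k =>
    tendsto_sub_nhds_zero_iff.2 ((AffineTendsto.coord (some (some k))).tendsto_mean hX hY hm)
  have hmy : Tendsto (fun q : ℕ × Ω => mean (fun i : Fin q.1 => Ys i q.2) - P₀[Y])
      (inProb P) (𝓝 0) :=
    tendsto_sub_nhds_zero_iff.2 ((AffineTendsto.coord (some none)).tendsto_mean hX hY hm)
  have hr := measurable_resp P₀[Y] (fun j => P₀[X j]) (alpha P₀ Y X)
  have hg := measurable_regr P₀[Y] (fun j => P₀[X j]) (theta P₀ Y X)
  have t1 := fun k => tight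
    (f := fun z => (z.2 k - P₀[X k]) * resp P₀[Y] (fun j => P₀[X j]) (alpha P₀ Y X) z)
    (by fun_prop) (memLp_two_mul ((hX k).sub (memLp_const _)) (memLp_epsC hX hY))
    (integral_mul_epsC hX2 hY2 k) (tendsto_sub_nhds_zero_iff.2 (tendsto_pi_nhds.1 ha k))
  have t2 := fun k => tight hr (memLp_epsC hX2 hY2) (integral_epsC hX2 hY2)
    (by simpa using (tendsto_pi_nhds.1 ha k).mul (hmx k))
  have t3 := fun k => tight
    (f := fun z => (z.1 - P₀[Y]) * regr P₀[Y] (fun j => P₀[X j]) (theta P₀ Y X) k z)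
    (by fun_prop) (memLp_two_mul (hY.sub (memLp_const _)) (memLp_eResC hX hY k))
    (integral_sub_mul_eResC hX2 hY2 hv k) (tendsto_sub_nhds_zero_iff.2 (hb k))
  have t4 := fun k => tight (hg k) (memLp_eResC hX2 hY2 k) (integral_eResC hX2 hY2 k)
    (by simpa using (hb k).mul hmy)
  have hsum := (tendsto_finsetSum Finset.univ fun k _ => (t1 k).sub (t2 k)).add
    (tendsto_finsetSum Finset.univ fun k _ => (t3 k).sub (t4 k))
  simp only [sub_zero, Finset.sum_const_zero, add_zero] at hsum
  refine hsum.congr' ?_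
  filter_upwards [hN, eventually_isUnit_det_covHat hX hY hm hlin, hvar.eventually_ne hv]
    with q h1 h2 h3
  rw [Rsq_eq hX2 hY2]
  exact (sqrt_mul_RsqHat_sub h1 h2 h3 _ _ _ _ _ _ _).symm

end Main

/-- Dividing by the deterministic `√v` rather than by `√V̂_n` avoids a possibly zero denominator;
the randomness of the scale is carried by the threshold on the right. -/
theorem mem_confInterval_iff {n p : ℕ} (hn : n ≠ 0) {v : ℝ} (hv : 0 < v) (δ r : ℝ)
    (y : Fin n → ℝ) (x : Fin n → Fin p → ℝ) :
    r ∈ confInterval δ y x ↔ |√(n : ℝ) * (RsqHat y x - r) / √v| ≤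
      normalQuantile (1 - δ / 2) * √(asympVarHat y x) / √v := by
  have hs : 0 < √(n : ℝ) := Real.sqrt_pos.2 (by exact_mod_cast Nat.pos_of_ne_zero hn)
  have hv' : 0 < √v := Real.sqrt_pos.2 hv
  rw [abs_div, abs_of_pos hv', div_le_div_iff_of_pos_right hv', abs_mul, abs_of_pos hs,
    ← le_div_iff₀' hs, abs_le, confInterval, Set.mem_Icc]
  constructor <;> rintro ⟨h1, h2⟩ <;> constructor <;> linarith

end MultipleCorrelation

theorem corollary3p1 {Ω₀ Ω : Type*} [MeasurableSpace Ω₀] [MeasurableSpace Ω]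
    (P₀ : Measure Ω₀) [IsProbabilityMeasure P₀] (P : Measure Ω) [IsProbabilityMeasure P]
    {p : ℕ} (Y : Ω₀ → ℝ) (X : Fin p → Ω₀ → ℝ)
    (Ys : ℕ → Ω → ℝ) (Xs : ℕ → Fin p → Ω → ℝ)
    -- the observations are independent copies of the vector `(Y, X⁽¹⁾, …, X⁽ᵖ⁾)`
    (h_indep : iIndepFun (fun i ω => (Ys i ω, fun j => Xs i j ω)) P)
    (h_copy : ∀ i, IdentDistrib (fun ω => (Ys i ω, fun j => Xs i j ω))
      (fun ω => (Y ω, fun j => X j ω)) P P₀)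
    (h_lin : MultipleCorrelation.LinIndepWithConst P₀ X)
    (hX4 : ∀ j, MemLp (X j) 4 P₀) (hY4 : MemLp Y 4 P₀)
    (h_varY : 0 < Var[Y; P₀])
    (hV : 0 < MultipleCorrelation.asympVar P₀ Y X)
    (δ : ℝ) (hδ : δ ∈ Set.Ioo (0 : ℝ) 1) :
    Tendsto
      (fun n : ℕ => P.real {ω | MultipleCorrelation.Rsq P₀ Y X ∈
        MultipleCorrelation.confInterval δ (fun i : Fin n => Ys i ω) (fun i j => Xs i j ω)})
      atTop (𝓝 (1 - δ)) := by
  open MultipleCorrelation in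
  have hX2 : ∀ j, MemLp (X j) 2 P₀ := fun j => (hX4 j).mono_exponent (by norm_num)
  have hY2 : MemLp Y 2 P₀ := hY4.mono_exponent (by norm_num)
  have hv := h_varY.ne'
  have hm := momentsTendsto_inProb h_indep h_copy hX4 hY4
  have hN : ∀ᶠ q : ℕ × Ω in inProb P, q.1 ≠ 0 :=
    (tendsto_fst_inProb P).eventually (eventually_ne_atTop 0)
  have hq : 1 - δ / 2 ∈ Set.Ioo (1 / 2 : ℝ) 1 := ⟨by linarith [hδ.2], by linarith [hδ.1]⟩
  have hsV : √(asympVar P₀ Y X) ≠ 0 := (Real.sqrt_pos.2 hV).ne'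
  have hclt := tendstoInDistribution_sqrt_mul_mean h_indep h_copy
    (measurable_influenceFun P₀[Y] (fun j => P₀[X j]) (alpha P₀ Y X) (theta P₀ Y X)
      ((M0 P₀ X)⁻¹ *ᵥ theta P₀ Y X) fun k => alpha P₀ Y X k / Var[Y; P₀])
    (integral_influence hX2 hY2 hv) hV (asympVar_eq hX4 hY4 hv).symm
  have hD := (tendsto_sqrt_mul_RsqHat_sub h_indep h_copy h_lin hX4 hY4 hv).div_const
    √(asympVar P₀ Y X)
  have hQ := ((tendsto_asympVarHat hX4 hY4 hm hN h_lin hv).sqrt.const_mul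
    (normalQuantile (1 - δ / 2))).div_const √(asympVar P₀ Y X)
  -- Since `V > 0`, the random threshold converges in probability to the normal quantile itself.
  rw [mul_div_cancel_right₀ _ hsV] at hQ
  simp only [sub_div, zero_div] at hD
  rw [← gaussianReal_real_Icc_normalQuantile hδ]
  refine tendsto_measureReal_of_tendstoInDistribution hclt (normalQuantile_pos hq) hD hQ ?_
  filter_upwards [hN] with q hq
  exact mem_confInterval_iff hq hV _ _ _ _
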